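/- Let $K$ be an algebraically closed field and let $0\le d<n$ be integers. Write $\mathrm{Gr}(m,n)$ for the Grassmannian of $m$-dimensional linear subspaces of $K^n$ with the Zariski topology of its Plücker embedding. For $X\in \mathrm{Gr}(d+1,n)$ let $L(X)\subset \mathrm{Gr}(d,n)\subset\mathbb P^{\binom nd-1}$ be the set of $d$-dimensional linear subspaces of $K^n$ contained in $X$, in Plücker coordinates indexed by $\binom{[n]}{d}$. If $W$ is a $(d+1)\times n$ matrix with row space $X$, let $V$ be the $(d+1)\times\binom nd$ matrix whose entry $V_{i,J}$ is the minor of $W$ on the columns in $J$ and all rows except the $i$-th; call $X$ generic if every maximal minor of $V$ that does not vanish identically on $\mathrm{Gr}(d+1,n)$ is nonzero at $X$ (this does not depend on the choice of $W$). The matroid of a linear subspace of $\mathbb P^{N-1}$ is the matroid on the set of coordinates in which a set is independent if and only if the corresponding coordinate functions are linearly independent as linear forms on the subspace. For $1\le k\le n$, the Dilworth truncation $\mathrm{Dil}_k(U_{n,n})$ of the free matroid $U_{n,n}$ is the matroid on the $k$-element subsets of $[n]$ (the rank-$k$ flats of $U_{n,n}$) in which a set $\{J_1,\dots,J_m\}$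 is independent if and only if the union of any $s>0$ distinct members has at least $s+k-1$ elements; $\widetilde{\mathrm{Dil}}_k(U_{n,n})$ is the matroid on $\binom{[n]}{n-k}$ obtained from it by renaming each element to its complement in $[n]$. **Theorem.** The generic subspaces form a Zariski open dense subset of $\mathrm{Gr}(d+1,n)$. If $X\in\mathrm{Gr}(d+1,n)$ is generic, then: 1. $L(X)$ is a linear subspace of $\mathbb P^{\binom nd-1}$, and its matroid equals $\widetilde{\mathrm{Dil}}_{n-d}(U_{n,n})$. 2. Let $\mathrm{val}:K\to\mathbb R\cup\{\infty\}$ be a non-trivial non-Archimedean valuation, and suppose that $X$ is defined by linear equations with coefficients in a subfield of $K$ on which $\mathrm{val}$ is trivial. Then $\mathrm{trop}(L(X))$, the closure in $\mathbb R^{\binom nd}/\mathbb R\mathbf 1$ of the set of vectors $(-\mathrm{val}(p_J))_J$ for points $p\in L(X)$ with all coordinates nonzero, is the Bergman fan of $\widetilde{\mathrm{Dil}}_{n-d}(U_{n,n})$, that is, the union, over all chains $F_1\subsetneq\dots\subsetneq F_r$ ($r\ge 0$) of nonempty proper flats of this matroid, of the cones in $\mathbb R^{\binom nd}/\mathbb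 R\mathbf 1$ spanned by $-e_{F_1},\dots,-e_{F_r}$, where $e_F=\sum_{J\in F}e_J$. -/

import Mathlib

open Set Topology

/-! ### The linear matroid of a coordinate subspace -/

/-- The matroid on `E` of a linear subspace `W` of `K^E`: a set of indices is independent when the
corresponding coordinate functions are linearly independent as linear forms on `W`. If `W` is the
row space of a matrix, this is the matroid of the columns of that matrix; its circuits are the
minimal supports of the nonzero linear forms vanishing on `W`. -/
noncomputable def subspaceMatroid {K E : Type*} [Field K] [Finite E] (W : Submodule K (E → K)) :
    Matroid E :=
  (IndepMatroid.ofFinite (E := Set.univ) Set.finite_univ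
    (fun I => LinearIndepOn K (fun e : E => (LinearMap.proj e : (E → K) →ₗ[K] K).domRestrict W) I)
    (linearIndepOn_empty _ _)
    (fun _ _ hJ hIJ => hJ.mono hIJ)
    (by
      intro I J hI hJ hlt
      by_contra! hcon
      set f : E → (W →ₗ[K] K) :=
        fun e : E => (LinearMap.proj e : (E → K) →ₗ[K] K).domRestrict W with hf
      have hsub : f '' J ⊆ Submodule.span K (f '' I) := by
        rintro _ ⟨e, he, rfl⟩
        by_cases heI : e ∈ I
        · exact Submodule.subset_span ⟨e, heI, rfl⟩
        · by_contra hs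
          exact hcon e he heI ((linearIndepOn_insert heI).2 ⟨hI, hs⟩)
      have h1 : Set.finrank K (f '' J) ≤ Set.finrank K (f '' I) :=
        Submodule.finrank_mono (Submodule.span_le.2 hsub)
      have key : ∀ S : Set E, LinearIndepOn K f S → Set.finrank K (f '' S) = S.ncard := by
        intro S hS
        have := Fintype.ofFinite S
        have h2 := finrank_span_eq_card hS
        rw [← Nat.card_eq_fintype_card, Nat.card_coe_set_eq] at h2
        rw [← h2, Set.finrank, Set.image_eq_range]
      rw [key I hI, key J hJ] at h1
      omega)
    (fun _ _ => Set.subset_univ _)).matroid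

/-! ### Dilworth truncations -/

/-- The augmentation step for the independent sets obtained from a monotone submodular function
`g` with `g {e} = k` on the ground set. -/
theorem dilworth_augment {β : Type*} [DecidableEq β] (g : Finset β → ℕ) (k : ℕ)
    (hmono : ∀ S T, S ⊆ T → g S ≤ g T)
    (hsub : ∀ S T, g (S ∪ T) + g (S ∩ T) ≤ g S + g T)
    (I J : Finset β)
    (hI : ∀ S ⊆ I, S.Nonempty → S.card + k ≤ g S + 1)
    (hJ : ∀ S ⊆ J, S.Nonempty → S.card + k ≤ g S + 1)
    (hone : ∀ e ∈ J, g {e} = k)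
    (hlt : I.card < J.card) :
    ∃ e ∈ J, e ∉ I ∧ ∀ S ⊆ insert e I, S.Nonempty → S.card + k ≤ g S + 1 := by
  classical
  by_contra! hcon
  -- every element of `J \ I` is spanned by a tight subset of `I`
  have h1 : ∀ e ∈ J \ I, ∃ T ⊆ I, T.Nonempty ∧ T.card + k = g T + 1 ∧ g (insert e T) = g T := by
    intro e he
    rw [Finset.mem_sdiff] at he
    obtain ⟨S, hS, hSne, hSlt⟩ := hcon e he.1 he.2
    have heS : e ∈ S := by
      by_contra heS
      have : S ⊆ I := fun x hx => by
        rcases Finset.mem_insert.1 (hS hx) with rfl | h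
        · exact absurd hx heS
        · exact h
      have := hI S this hSne
      omega
    have hTI : S.erase e ⊆ I := fun x hx => by
      rw [Finset.mem_erase] at hx
      rcases Finset.mem_insert.1 (hS hx.2) with h | h
      · exact absurd h hx.1
      · exact h
    have hcard := Finset.card_erase_add_one heS
    have hle : g (S.erase e) ≤ g S := hmono _ _ (Finset.erase_subset _ _)
    rcases (S.erase e).eq_empty_or_nonempty with h0 | hne
    · have hSe : S = {e} := by
        rw [← Finset.insert_erase heS, h0]; rfl
      have := hone e he.1
      rw [hSe] at hSlt
      simp at hSlt
      omega
    · have := hI _ hTI hne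
      refine ⟨S.erase e, hTI, hne, by omega, ?_⟩
      rw [Finset.insert_erase heS]
      omega
  let Tight : Finset β → Prop := fun T => T ⊆ I ∧ T.Nonempty ∧ T.card + k = g T + 1
  have hunion : ∀ S T, Tight S → Tight T → (S ∩ T).Nonempty → Tight (S ∪ T) := by
    rintro S T ⟨hSI, hSn, hS⟩ ⟨hTI, hTn, hT⟩ hne
    refine ⟨Finset.union_subset hSI hTI, hSn.mono Finset.subset_union_left, ?_⟩
    have a := hI (S ∪ T) (Finset.union_subset hSI hTI) (hSn.mono Finset.subset_union_left)
    have b := hI (S ∩ T) (Finset.inter_subset_left.trans hSI) hne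
    have c := hsub S T
    have d := Finset.card_union_add_card_inter S T
    omega
  -- enlarge to a maximal tight set
  have h2 : ∀ e ∈ J \ I, ∃ T, Maximal Tight T ∧ g (insert e T) = g T := by
    intro e he
    obtain ⟨T, hTI, hTn, hT, hg⟩ := h1 e he
    have hfin : {S | Tight S}.Finite :=
      (Finset.finite_toSet I.powerset).subset fun S hS => by
        simpa using hS.1
    obtain ⟨M, hTM, hM⟩ := hfin.exists_le_maximal (show T ∈ {S | Tight S} from ⟨hTI, hTn, hT⟩)
    refine ⟨M, hM, le_antisymm ?_ (hmono _ _ (Finset.subset_insert _ _))⟩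
    have hTM' : T ⊆ M := hTM
    have a := hsub (insert e T) M
    have b : insert e T ∪ M = insert e M := by
      rw [Finset.insert_union, Finset.union_eq_right.2 hTM']
    have c : g T ≤ g (insert e T ∩ M) :=
      hmono _ _ (Finset.subset_inter (Finset.subset_insert _ _) hTM')
    rw [b] at a
    omega
  choose! τ hτmax hτg using h2
  have hspan : ∀ (T A : Finset β), (∀ e ∈ A, g (insert e T) = g T) → g (T ∪ A) = g T := by
    intro T A
    induction A using Finset.induction_on with
    | empty => simp
    | insert a A ha ih =>
      intro h
      have ih' := ih fun e he => h e (Finset.mem_insert_of_mem he)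
      have h3 := h a (Finset.mem_insert_self _ _)
      have a1 := hsub (T ∪ A) (insert a T)
      have a2 : (T ∪ A) ∪ insert a T = T ∪ insert a A := by
        ext x; simp only [Finset.mem_union, Finset.mem_insert]; tauto
      have a3 : g T ≤ g ((T ∪ A) ∩ insert a T) :=
        hmono _ _ (Finset.subset_inter Finset.subset_union_left (Finset.subset_insert _ _))
      have a4 : g T ≤ g (T ∪ insert a A) := hmono _ _ Finset.subset_union_left
      rw [a2] at a1
      omega
  have hfib : ∀ T ∈ (J \ I).image τ, ((J \ I).filter fun e => τ e = T).card ≤ (T \ J).card := by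
    intro T hT
    obtain ⟨e₀, he₀, rfl⟩ := Finset.mem_image.1 hT
    set F := (J \ I).filter fun e => τ e = τ e₀ with hF
    have hFJ : F ⊆ J := fun x hx => (Finset.mem_sdiff.1 (Finset.mem_filter.1 hx).1).1
    have hTt : Tight (τ e₀) := (hτmax e₀ he₀).prop
    have hg : g (τ e₀ ∪ F) = g (τ e₀) := hspan _ _ fun e he => by
      have h := Finset.mem_filter.1 he
      rw [← h.2]; exact hτg e h.1
    have hdis : Disjoint (J ∩ τ e₀) F := by
      rw [Finset.disjoint_left]
      intro x hx hx'
      exact (Finset.mem_sdiff.1 (Finset.mem_filter.1 hx').1).2 (hTt.1 (Finset.mem_inter.1 hx).2)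
    have hUne : ((J ∩ τ e₀) ∪ F).Nonempty :=
      ⟨e₀, Finset.mem_union_right _ (Finset.mem_filter.2 ⟨he₀, rfl⟩)⟩
    have b1 := hJ ((J ∩ τ e₀) ∪ F) (Finset.union_subset Finset.inter_subset_left hFJ) hUne
    have b2 : g ((J ∩ τ e₀) ∪ F) ≤ g (τ e₀ ∪ F) :=
      hmono _ _ (Finset.union_subset_union_left Finset.inter_subset_right)
    rw [Finset.card_union_of_disjoint hdis] at b1
    have b3 := hTt.2.2
    have b4 := Finset.card_sdiff_add_card_inter (τ e₀) J
    rw [Finset.inter_comm] at b4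
    omega
  have hpd : ((((J \ I).image τ : Finset (Finset β)) : Set (Finset β))).PairwiseDisjoint
      (fun T => T \ J) := by
    intro S hS T hT hST
    obtain ⟨s, hs, rfl⟩ := Finset.mem_image.1 (Finset.mem_coe.1 hS)
    obtain ⟨t, ht, rfl⟩ := Finset.mem_image.1 (Finset.mem_coe.1 hT)
    refine Finset.disjoint_left.2 fun x hx hx' => hST ?_
    have hu := hunion _ _ (hτmax s hs).prop (hτmax t ht).prop
      ⟨x, Finset.mem_inter.2 ⟨(Finset.mem_sdiff.1 hx).1, (Finset.mem_sdiff.1 hx').1⟩⟩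
    have e1 := (hτmax s hs).eq_of_le hu Finset.subset_union_left
    have e2 := (hτmax t ht).eq_of_le hu Finset.subset_union_right
    exact e1.trans e2.symm
  have hfinal : (J \ I).card ≤ (I \ J).card := by
    rw [Finset.card_eq_sum_card_image τ (J \ I)]
    refine (Finset.sum_le_sum hfib).trans ?_
    rw [← Finset.card_biUnion hpd]
    refine Finset.card_le_card fun x hx => ?_
    obtain ⟨T, hT, hxT⟩ := Finset.mem_biUnion.1 hx
    obtain ⟨t, ht, rfl⟩ := Finset.mem_image.1 hT
    rw [Finset.mem_sdiff] at hxT ⊢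
    exact ⟨(hτmax t ht).prop.1 hxT.1, hxT.2⟩
  have c1 := Finset.card_sdiff_add_card_inter J I
  have c2 := Finset.card_sdiff_add_card_inter I J
  rw [Finset.inter_comm] at c2
  omega

/-- Independence in the `k`-th Dilworth truncation of `M`: a set of rank-`k` flats such that the
union of any `s > 0` of them has rank at least `s + k - 1` in `M`. -/
def DilworthIndep {α : Type*} (M : Matroid α) (k : ℕ) (I : Set (Set α)) : Prop :=
  (∀ F ∈ I, M.IsFlat F ∧ M.eRk F = k) ∧
    ∀ S ⊆ I, S.Nonempty → S.encard + k ≤ M.eRk (⋃₀ S) + 1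

/-- The `k`-th Dilworth truncation of a matroid `M` on a finite set, for `1 ≤ k ≤ rank M`. Its
ground set is the set of flats of rank `k` of `M`. -/
noncomputable def dilworthTruncation {α : Type*} [Finite α] (M : Matroid α) (k : ℕ) :
    Matroid (Set α) :=
  (IndepMatroid.ofFinite (E := {F : Set α | M.IsFlat F ∧ M.eRk F = k}) (Set.toFinite _)
    (DilworthIndep M k)
    ⟨by simp, by
      intro S hS hne
      exact absurd (Set.subset_empty_iff.1 hS) hne.ne_empty⟩
    (fun _ _ hJ hIJ => ⟨fun F hF => hJ.1 F (hIJ hF), fun S hS => hJ.2 S (hS.trans hIJ)⟩)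
    (by
      classical
      intro I J hI hJ hlt
      let g : Finset (Set α) → ℕ := fun S => (M.eRk (⋃₀ (S : Set (Set α)))).toNat
      have hfin : ∀ X : Set α, M.eRk X ≠ ⊤ := fun X =>
        ((M.eRk_le_encard X).trans_lt (Set.toFinite X).encard_lt_top).ne
      have hg : ∀ S, (g S : ℕ∞) = M.eRk (⋃₀ (S : Set (Set α))) := fun S => by
        rw [ENat.natCast_toNat (hfin _)]
      have hcast : ∀ S : Finset (Set α),
          (((S : Set (Set α)).encard + k ≤ M.eRk (⋃₀ (S : Set (Set α))) + 1) ↔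
            S.card + k ≤ g S + 1) := fun S => by
        rw [Set.encard_coe_eq_coe_finsetCard, ← hg]
        norm_cast
      obtain ⟨I, rfl⟩ := (Set.toFinite I).exists_finset_coe
      obtain ⟨J, rfl⟩ := (Set.toFinite J).exists_finset_coe
      rw [Set.ncard_coe_finset, Set.ncard_coe_finset] at hlt
      obtain ⟨e, heJ, heI, he⟩ := dilworth_augment g k
        (fun S T hST => by
          have := M.eRk_mono (Set.sUnion_subset_sUnion (Finset.coe_subset.2 hST))
          rw [← hg, ← hg] at this
          exact_mod_cast this)
        (fun S T => by
          have h1 := M.eRk_inter_add_eRk_union_le (⋃₀ (S : Set (Set α))) (⋃₀ (T : Set (Set α)))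
          have h2 := M.eRk_mono (Set.subset_inter
            (Set.sUnion_subset_sUnion (Set.inter_subset_left (s := (S : Set (Set α)))
              (t := (T : Set (Set α)))))
            (Set.sUnion_subset_sUnion (Set.inter_subset_right (s := (S : Set (Set α)))
              (t := (T : Set (Set α))))))
          rw [← Set.sUnion_union, ← Finset.coe_union, ← hg, ← hg, ← hg] at h1
          rw [← Finset.coe_inter, ← hg] at h2
          have h3 := (add_le_add_left h2 (g (S ∪ T) : ℕ∞)).trans h1
          have h4 : g (S ∩ T) + g (S ∪ T) ≤ g S + g T := by exact_mod_cast h3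
          omega)
        I J
        (fun S hS hne => (hcast S).1 (hI.2 _ (Finset.coe_subset.2 hS) hne))
        (fun S hS hne => (hcast S).1 (hJ.2 _ (Finset.coe_subset.2 hS) hne))
        (fun e he => by
          have := (hJ.1 e he).2
          have h := hg {e}
          rw [Finset.coe_singleton, Set.sUnion_singleton, this] at h
          exact_mod_cast h)
        hlt
      refine ⟨e, heJ, heI, ?_, ?_⟩
      · rintro F (rfl | hF)
        · exact hJ.1 _ heJ
        · exact hI.1 F hF
      · intro S hS hne
        obtain ⟨S, rfl⟩ := (Set.toFinite S).exists_finset_coe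
        refine (hcast S).2 (he S ?_ hne)
        rw [← Finset.coe_subset, Finset.coe_insert]
        exact hS)
    (fun _ hI F hF => hI.1 F hF)).matroid

/-- The `d`-element subsets of `{0, …, n-1}`. -/
abbrev SubsetsOfCard (n d : ℕ) : Type := {J : Finset (Fin n) // J.card = d}

/-- The relabeled Dilworth truncation of the free matroid `U_{n,n}`, for `d = n - k`: the matroid
on the `d`-element subsets of `{0, …, n-1}` in which each flat of rank `k` of `U_{n,n}` (an
arbitrary `k`-element set) has been renamed to its complement. -/
noncomputable def relabeledDilworth (n k d : ℕ) : Matroid (SubsetsOfCard n d) :=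
  (dilworthTruncation (Matroid.freeOn (Set.univ : Set (Fin n))) k).comap
    fun J => ((J.1 : Set (Fin n)))ᶜ

/-! ### Grassmannians, Plücker coordinates and the space `L(X)` -/

/-- The Grassmannian of `m`-dimensional linear subspaces of `K^n`. -/
def Gr (K : Type*) [Field K] (m n : ℕ) : Type _ :=
  {X : Submodule K (Fin n → K) // Module.finrank K X = m}

/-- The determinant of the square submatrix of `M` on the columns in `I` (in increasing order). -/
def maxMinor {K : Type*} [Field K] {m n : ℕ} (M : Matrix (Fin m) (Fin n) K)
    (I : SubsetsOfCard n m) : K :=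
  (M.submatrix id (I.1.orderEmbOfFin I.2)).det

/-- `L` is the row space of `M`. -/
def IsRowSpace {K : Type*} [Field K] {m n : ℕ} (M : Matrix (Fin m) (Fin n) K)
    (L : Submodule K (Fin n → K)) : Prop :=
  L = Submodule.span K (Set.range M.row)

/-- `p` is a vector of homogeneous Plücker coordinates of the point `L` of the Grassmannian. -/
def IsPluckerVector {K : Type*} [Field K] {m n : ℕ} (L : Gr K m n)
    (p : SubsetsOfCard n m → K) : Prop :=
  ∃ (M : Matrix (Fin m) (Fin n) K) (c : K), IsRowSpace M L.1 ∧ c ≠ 0 ∧ p = fun I => c * maxMinor M I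

/-- The Zariski topology of the Grassmannian in its Plücker embedding: the topology generated by
the nonvanishing loci of homogeneous polynomials in the Plücker coordinates. -/
instance Gr.zariskiTopology (K : Type*) [Field K] (m n : ℕ) : TopologicalSpace (Gr K m n) :=
  TopologicalSpace.generateFrom
    {U | ∃ (f : MvPolynomial (SubsetsOfCard n m) K) (N : ℕ), f.IsHomogeneous N ∧
      U = {X | ∀ p, IsPluckerVector X p → MvPolynomial.eval p f ≠ 0}}

/-- The affine cone over the space `L(X)` of `d`-dimensional linear subspaces contained in `X`,
inside the space of Plücker coordinates: all homogeneous Plücker vectors of such subspaces,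
together with the origin. -/
def spaceLCone {K : Type*} [Field K] {n : ℕ} (d : ℕ) (X : Submodule K (Fin n → K)) :
    Set (SubsetsOfCard n d → K) :=
  insert 0 {p | ∃ L : Gr K d n, L.1 ≤ X ∧ IsPluckerVector L p}

/-- The matroid of `L(X)`, i.e. of the linear subspace whose underlying set is the cone over
`L(X)`. -/
noncomputable def matroidOfL {K : Type*} [Field K] {n : ℕ} (d : ℕ)
    (X : Submodule K (Fin n → K)) : Matroid (SubsetsOfCard n d) :=
  subspaceMatroid (Submodule.span K (spaceLCone d X))

/-! ### Generic subspaces -/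

/-- The matrix `V` of concrete coordinates of `L(X)` attached to a matrix `W` with row space `X`:
the entry in row `i` and column `J` is the minor of `W` on the columns in `J` and all rows but the
`i`-th. -/
def concreteCoordinates {K : Type*} [Field K] {d n : ℕ} (W : Matrix (Fin (d + 1)) (Fin n) K) :
    Matrix (Fin (d + 1)) (SubsetsOfCard n d) K :=
  Matrix.of fun i J => maxMinor (W.submatrix i.succAbove id) J

/-- The maximal minor of `V` on the columns `J 0, …, J d` does not vanish at `X`. (Another matrix
`W` with the same row space multiplies all these minors by one common nonzero scalar.) -/
def MinorNonvanishing {K : Type*} [Field K] {d n : ℕ} (X : Gr K (d + 1) n)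
    (J : Fin (d + 1) → SubsetsOfCard n d) : Prop :=
  ∀ W : Matrix (Fin (d + 1)) (Fin n) K, IsRowSpace W X.1 →
    ((concreteCoordinates W).submatrix id J).det ≠ 0

/-- The generic subspaces: those at which every maximal minor of `V` that is not identically zero
on the Grassmannian is nonzero. -/
def genericLocus (K : Type*) [Field K] (d n : ℕ) : Set (Gr K (d + 1) n) :=
  {X | ∀ J : Fin (d + 1) → SubsetsOfCard n d,
    (∃ X' : Gr K (d + 1) n, MinorNonvanishing X' J) → MinorNonvanishing X J}

/-! ### Tropicalizations and Bergman fans -/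

/-- The tropical projective torus `ℝ^E / ℝ(1, …, 1)`. -/
abbrev TropicalTorus (E : Type*) : Type _ := (E → ℝ) ⧸ Submodule.span ℝ {(1 : E → ℝ)}

/-- The tropicalization of the projective variety with affine cone `Y`: the closure of the set of
coordinatewise negative valuations of the points of `Y` all of whose coordinates are nonzero.
(The valuation of a nonzero element is a real number, so the default value is not used.) -/
def tropicalization {K E : Type*} [Field K] (v : AddValuation K (WithTop ℝ)) (Y : Set (E → K)) :
    Set (TropicalTorus E) :=
  closure {x | ∃ p ∈ Y, (∀ e, p e ≠ 0) ∧
    x = Submodule.Quotient.mk (fun e => -(v (p e)).untopD 0)}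

/-- The cone in `ℝ^E / ℝ(1, …, 1)` spanned by the vectors `-e_F` for `F` in `C`. (The sign is
that of the maximum convention, where tropicalizing takes the negative of the valuation.) -/
def flagCone {E : Type*} (C : Finset (Set E)) : Set (TropicalTorus E) :=
  {x | ∃ c : Set E → ℝ, (∀ F ∈ C, 0 ≤ c F) ∧
    x = Submodule.Quotient.mk (∑ F ∈ C, c F • -(F.indicator (1 : E → ℝ)))}

/-- The Bergman fan of a matroid `M` with ground set `E` (empty if `M` has loops): the fan over the
order complex of the lattice of flats, i.e. the union of the cones of all chains of nonempty proper
flats. -/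
def bergmanFan {E : Type*} (M : Matroid E) : Set (TropicalTorus E) :=
  {x | M.Loopless ∧ ∃ C : Finset (Set E), (∀ F ∈ C, M.IsFlat F ∧ F.Nonempty ∧ F ≠ M.E) ∧
    IsChain (· ⊆ ·) (C : Set (Set E)) ∧ x ∈ flagCone C}

/-- `X` is cut out by linear equations with coefficients in the subfield `k`. -/
def HasEquationsOver {K : Type*} [Field K] {n : ℕ} (k : Subfield K)
    (X : Submodule K (Fin n → K)) : Prop :=
  ∃ S : Set (Fin n → K), (∀ a ∈ S, ∀ i, a i ∈ k) ∧ (X : Set (Fin n → K)) = {x | ∀ a ∈ S, a ⬝ᵥ x = 0}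

/-! ### Minors and changes of basis -/

section Minors

variable {K : Type*} [Field K] {m n d : ℕ}

/-! Fix a matrix `W` with row space `X`. The vectors J ↦ det [x | W_J] form the row space of
`concreteCoordinates W`, since Laplace expansion along the column x writes them as signed
combinations of the rows. They are exactly the Plücker vectors of the d-dimensional subspaces of
`X`, together with 0 (`spaceLCone_eq`): such a subspace is the row space of A * W, where A has d
independent rows, and completing A to an invertible matrix makes its minors values of these forms.
So L(X) is linear, and its matroid is that of the columns of V
(`subspaceMatroid_span_row_indep_iff`).

Column J of V is, up to signs, the normal vector of the hyperplane spanned by the columns W_J.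
Independent normals indexed by S all annihilate the columns of `W` in ⋂ S, and these are independent
too; hence |S| + |⋂ S| ≤ d + 1 (`card_add_card_commonPart_le`), which is Dilworth independence after
complementation (`relabeledDilworth_indep_iff`). Conversely, a Dilworth-independent set extends to d
+ 1 sets J_i. If row i of `W` is made to vanish on J_i, the corresponding minor of V becomes
diagonal, and Hall's theorem makes its diagonal nonzero
(`coordinateDet_mvPolynomialX_ne_zero_of_hall`). The minor is therefore not identically zero, so it
is nonzero at a generic `X`.

Openness holds because the minors of V are, on each Plücker chart, homogeneous polynomials in the
Plücker coordinates; density holds because a product of nonzero polynomials over an infinite field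
is nonzero somewhere.

For the tropical part, a weight lies in the Bergman fan iff its sublevel sets are flats
(`mk_mem_bergmanFan_iff`), a closed condition. Negative valuations satisfy it by the ultrametric
inequality (`flatSublevels_neg_valuation`). Conversely, weights with values in a lattice δℤ are
realized by power sums in an element of valuation δ (`exists_mem_span_row_valuation_eq`), and δ can
be taken arbitrarily small because K is algebraically closed. -/

theorem submatrix_id_mul {ι κ l o : Type*} [Fintype κ] (g : Matrix ι κ K)
    (W : Matrix κ l K) (f : o → l) :
    (g * W).submatrix id f = g * W.submatrix id f := by
  ext i j
  simp [Matrix.mul_apply]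

theorem maxMinor_mul (g : Matrix (Fin m) (Fin m) K) (W : Matrix (Fin m) (Fin n) K)
    (I : SubsetsOfCard n m) : maxMinor (g * W) I = g.det * maxMinor W I := by
  rw [maxMinor, submatrix_id_mul, Matrix.det_mul, maxMinor]

/-- The matrix `W_J` with an additional first column `x`. -/
def borderedMatrix (W : Matrix (Fin (d + 1)) (Fin n) K) (x : Fin (d + 1) → K)
    (J : SubsetsOfCard n d) : Matrix (Fin (d + 1)) (Fin (d + 1)) K :=
  Matrix.of fun i => Fin.cons (x i) fun j => W i (J.1.orderEmbOfFin J.2 j)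

/-- The linear form `x ↦ det [x | W_J]`, whose kernel is the hyperplane spanned by the columns of
`W` in `J`. -/
def hyperplaneForm (W : Matrix (Fin (d + 1)) (Fin n) K) (x : Fin (d + 1) → K)
    (J : SubsetsOfCard n d) : K :=
  (borderedMatrix W x J).det

theorem hyperplaneForm_eq_sum (W : Matrix (Fin (d + 1)) (Fin n) K) (x : Fin (d + 1) → K)
    (J : SubsetsOfCard n d) :
    hyperplaneForm W x J = ∑ i : Fin (d + 1), (-1) ^ (i : ℕ) * x i * concreteCoordinates W i J := by
  rw [hyperplaneForm, Matrix.det_succ_column_zero]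
  refine Finset.sum_congr rfl fun i _ => ?_
  congr 1

theorem borderedMatrix_mul (g : Matrix (Fin (d + 1)) (Fin (d + 1)) K)
    (W : Matrix (Fin (d + 1)) (Fin n) K) (x : Fin (d + 1) → K) (J : SubsetsOfCard n d) :
    borderedMatrix (g * W) (g.mulVec x) J = g * borderedMatrix W x J := by
  ext i j
  refine Fin.cases ?_ (fun j => ?_) j <;>
    simp [borderedMatrix, Matrix.mul_apply, Matrix.mulVec, dotProduct]

theorem hyperplaneForm_mul (g : Matrix (Fin (d + 1)) (Fin (d + 1)) K)
    (W : Matrix (Fin (d + 1)) (Fin n) K) (x : Fin (d + 1) → K) (J : SubsetsOfCard n d) :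
    hyperplaneForm (g * W) (g.mulVec x) J = g.det * hyperplaneForm W x J := by
  rw [hyperplaneForm, borderedMatrix_mul, Matrix.det_mul, hyperplaneForm]

/-- The diagonal matrix of the alternating signs. -/
def signMatrix (K : Type*) [Field K] (d : ℕ) : Matrix (Fin (d + 1)) (Fin (d + 1)) K :=
  Matrix.diagonal fun i => (-1) ^ (i : ℕ)

theorem signMatrix_mul_self : signMatrix K d * signMatrix K d = 1 := by
  rw [signMatrix, Matrix.diagonal_mul_diagonal, ← Matrix.diagonal_one]
  congr 1
  ext i
  rw [← mul_pow]; simp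

theorem hyperplaneForm_eq_vecMul (W : Matrix (Fin (d + 1)) (Fin n) K) (x : Fin (d + 1) → K) :
    hyperplaneForm W x = Matrix.vecMul x (signMatrix K d * concreteCoordinates W) := by
  ext J
  rw [hyperplaneForm_eq_sum]
  simp only [Matrix.vecMul, dotProduct, signMatrix, Matrix.diagonal_mul]
  exact Finset.sum_congr rfl fun i _ => by ring

/-- Compare the coefficients of x in det [gx | gW_J] = det g · det [x | W_J]. This stands in for a
computation with the compound matrix of g. -/
theorem transpose_mul_concreteCoordinates (g : Matrix (Fin (d + 1)) (Fin (d + 1)) K)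
    (W : Matrix (Fin (d + 1)) (Fin n) K) :
    g.transpose * (signMatrix K d * concreteCoordinates (g * W)) =
      g.det • (signMatrix K d * concreteCoordinates W) := by
  ext i J
  have h := hyperplaneForm_mul g W (Pi.single i 1) J
  rw [hyperplaneForm_eq_vecMul, hyperplaneForm_eq_vecMul, ← Matrix.vecMul_transpose,
    Matrix.vecMul_vecMul] at h
  simpa using h

/-- Taking determinants in the preceding identity gives det g on the left and det g ^ (d + 1) on the
right; cancelling one factor leaves the exponent d. -/
theorem det_concreteCoordinates_mul (g : Matrix (Fin (d + 1)) (Fin (d + 1)) K)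
    (W : Matrix (Fin (d + 1)) (Fin n) K) (J : Fin (d + 1) → SubsetsOfCard n d) (hg : g.det ≠ 0) :
    ((concreteCoordinates (g * W)).submatrix id J).det =
      g.det ^ d * ((concreteCoordinates W).submatrix id J).det := by
  have h := congrArg (fun A => (A.submatrix id J).det) (transpose_mul_concreteCoordinates g W)
  simp only [submatrix_id_mul, Matrix.det_mul, Matrix.submatrix_smul, Matrix.det_smul,
    Matrix.det_transpose, Fintype.card_fin, Pi.smul_apply] at h
  have hs : (signMatrix K d).det ≠ 0 := by
    intro h0
    have := congrArg Matrix.det (signMatrix_mul_self (K := K) (d := d))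
    simp [h0] at this
  refine mul_left_cancel₀ hg (mul_left_cancel₀ hs ?_)
  linear_combination h

end Minors

/-! ### Row spaces -/

section RowSpaces

variable {K : Type*} [Field K] {m n d : ℕ}

theorem IsRowSpace.linearIndependent {M : Matrix (Fin m) (Fin n) K} {X : Gr K m n}
    (h : IsRowSpace M X.1) : LinearIndependent K M.row := by
  rw [linearIndependent_iff_card_eq_finrank_span, Set.finrank, ← h, X.2, Fintype.card_fin]

theorem exists_isRowSpace (X : Gr K m n) : ∃ M : Matrix (Fin m) (Fin n) K, IsRowSpace M X.1 := by
  let b := Module.finBasisOfFinrankEq K X.1 X.2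
  refine ⟨Matrix.of fun i => (b i : Fin n → K), ?_⟩
  have h := congrArg (Submodule.map X.1.subtype) b.span_eq
  rw [Submodule.map_span, Submodule.map_subtype_top, ← Set.range_comp] at h
  exact h.symm

/-- The row space of a matrix with independent rows, as a point of the Grassmannian. -/
def grOfMatrix (M : Matrix (Fin m) (Fin n) K) (h : LinearIndependent K M.row) : Gr K m n :=
  ⟨Submodule.span K (Set.range M.row), by
    simpa using finrank_span_eq_card h⟩

theorem isRowSpace_grOfMatrix (M : Matrix (Fin m) (Fin n) K) (h : LinearIndependent K M.row) :
    IsRowSpace M (grOfMatrix M h).1 := rfl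

theorem exists_eq_mul_of_span_le {l : ℕ} {M : Matrix (Fin m) (Fin n) K}
    {M' : Matrix (Fin l) (Fin n) K}
    (h : Submodule.span K (Set.range M'.row) ≤ Submodule.span K (Set.range M.row)) :
    ∃ g : Matrix (Fin l) (Fin m) K, M' = g * M := by
  have h1 : ∀ i, ∃ c : Fin m → K, ∑ j, c j • M.row j = M'.row i := fun i =>
    (Submodule.mem_span_range_iff_exists_fun K).1 (h (Submodule.subset_span ⟨i, rfl⟩))
  choose c hc using h1
  refine ⟨Matrix.of c, ?_⟩
  ext i j
  have := congrFun (hc i) j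
  simp only [Finset.sum_apply, Pi.smul_apply, smul_eq_mul, Matrix.row] at this
  rw [← this, Matrix.mul_apply]
  rfl

theorem span_row_mul_le {l : ℕ} (g : Matrix (Fin l) (Fin m) K) (M : Matrix (Fin m) (Fin n) K) :
    Submodule.span K (Set.range (g * M).row) ≤ Submodule.span K (Set.range M.row) := by
  rw [Submodule.span_le]
  rintro _ ⟨i, rfl⟩
  refine (Submodule.mem_span_range_iff_exists_fun K).2 ⟨g i, ?_⟩
  ext j
  simp [Matrix.mul_apply, Matrix.row]

theorem span_row_mul_of_det_ne_zero {g : Matrix (Fin m) (Fin m) K} (hg : g.det ≠ 0)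
    (M : Matrix (Fin m) (Fin n) K) :
    Submodule.span K (Set.range (g * M).row) = Submodule.span K (Set.range M.row) := by
  refine le_antisymm (span_row_mul_le g M) ?_
  have h : M = g⁻¹ * (g * M) := by
    rw [← Matrix.mul_assoc, Matrix.nonsing_inv_mul _ (isUnit_iff_ne_zero.2 hg), Matrix.one_mul]
  conv_lhs => rw [h]
  exact span_row_mul_le _ _

theorem det_ne_zero_of_linearIndependent_mul {g : Matrix (Fin m) (Fin m) K}
    {M : Matrix (Fin m) (Fin n) K} (h : LinearIndependent K (g * M).row) : g.det ≠ 0 := by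
  intro h0
  obtain ⟨v, hv, hvg⟩ := Matrix.exists_vecMul_eq_zero_iff.2 h0
  have h1 : Matrix.vecMul v (g * M) = 0 := by
    rw [← Matrix.vecMul_vecMul, hvg, Matrix.zero_vecMul]
  exact hv (Matrix.vecMul_injective_iff.2 h (by simpa using h1))

theorem IsRowSpace.exists_eq_mul {M M' : Matrix (Fin m) (Fin n) K} {X : Gr K m n}
    (h : IsRowSpace M X.1) (h' : IsRowSpace M' X.1) :
    ∃ g : Matrix (Fin m) (Fin m) K, g.det ≠ 0 ∧ M' = g * M := by
  obtain ⟨g, rfl⟩ := exists_eq_mul_of_span_le (M := M) (M' := M') (by rw [← h, ← h'])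
  exact ⟨g, det_ne_zero_of_linearIndependent_mul h'.linearIndependent, rfl⟩

theorem IsRowSpace.mul {M : Matrix (Fin m) (Fin n) K} {X : Gr K m n}
    (h : IsRowSpace M X.1) {g : Matrix (Fin m) (Fin m) K} (hg : g.det ≠ 0) :
    IsRowSpace (g * M) X.1 := by
  rw [IsRowSpace, span_row_mul_of_det_ne_zero hg]; exact h

theorem linearIndependent_row_of_maxMinor_ne_zero {M : Matrix (Fin m) (Fin n) K}
    {I : SubsetsOfCard n m} (h : maxMinor M I ≠ 0) : LinearIndependent K M.row := by
  refine Matrix.vecMul_injective_iff.1 ?_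
  rw [← Matrix.coe_vecMulLinear, ← LinearMap.ker_eq_bot, LinearMap.ker_eq_bot']
  intro v hv
  by_contra hv0
  refine h (Matrix.exists_vecMul_eq_zero_iff.1 ⟨v, hv0, ?_⟩)
  ext j
  exact congrFun hv (I.1.orderEmbOfFin I.2 j)

/-- Row rank equals column rank, so some m columns form a basis of the column space. -/
theorem exists_maxMinor_ne_zero {M : Matrix (Fin m) (Fin n) K} (h : LinearIndependent K M.row) :
    ∃ I : SubsetsOfCard n m, maxMinor M I ≠ 0 := by
  classical
  have hr : M.rank = m := by simpa using h.rank_matrix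
  rw [Matrix.rank_eq_finrank_span_cols] at hr
  obtain ⟨s, hs, hsp, hli⟩ := exists_linearIndependent K (Set.range M.col)
  obtain ⟨T, hT, hinj⟩ := Set.SurjOn.exists_bijOn_subset (f := M.col) (s := Set.univ) (t := s)
    (fun x hx => by simpa using hs hx)
  have hTli : LinearIndepOn K M.col T := by
    rw [← hinj.image_eq] at hli
    exact (linearIndepOn_iff_image hinj.injOn).2 hli
  have hcard : T.toFinset.card = m := by
    rw [← hsp, ← hinj.image_eq] at hr
    have h2 := finrank_span_eq_card hTli
    rw [← Set.image_eq_range] at h2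
    rw [h2] at hr
    rw [← hr]; simp
  refine ⟨⟨T.toFinset, hcard⟩, ?_⟩
  have hli2 : LinearIndependent K
      (fun j => M.col (T.toFinset.orderEmbOfFin hcard j)) := by
    have := hTli.comp (fun j : Fin m => (⟨T.toFinset.orderEmbOfFin hcard j, by
      exact Set.mem_toFinset.1 (Finset.orderEmbOfFin_mem T.toFinset hcard j)⟩ : T)) (by
        intro a b hab; simpa using hab)
    exact this
  have hu := Matrix.linearIndependent_cols_iff_isUnit (A := M.submatrix id (T.toFinset.orderEmbOfFin hcard)) |>.1 hli2
  exact ((Matrix.isUnit_iff_isUnit_det _).1 hu).ne_zero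

theorem minorNonvanishing_iff {X : Gr K (d + 1) n} {W : Matrix (Fin (d + 1)) (Fin n) K}
    (h : IsRowSpace W X.1) (J : Fin (d + 1) → SubsetsOfCard n d) :
    MinorNonvanishing X J ↔ ((concreteCoordinates W).submatrix id J).det ≠ 0 := by
  refine ⟨fun H => H W h, fun H W' h' => ?_⟩
  obtain ⟨g, hg, rfl⟩ := h.exists_eq_mul h'
  rw [det_concreteCoordinates_mul g W J hg]
  exact mul_ne_zero (pow_ne_zero _ hg) H

theorem isPluckerVector_iff {X : Gr K m n} {W : Matrix (Fin m) (Fin n) K}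
    (h : IsRowSpace W X.1) (p : SubsetsOfCard n m → K) :
    IsPluckerVector X p ↔ ∃ c : K, c ≠ 0 ∧ p = c • maxMinor W := by
  constructor
  · rintro ⟨M, c, hM, hc, rfl⟩
    obtain ⟨g, hg, rfl⟩ := h.exists_eq_mul hM
    refine ⟨c * g.det, mul_ne_zero hc hg, ?_⟩
    ext I
    rw [maxMinor_mul, Pi.smul_apply, smul_eq_mul, mul_assoc]
  · rintro ⟨c, hc, rfl⟩
    exact ⟨W, c, h, hc, rfl⟩

end RowSpaces

/-! ### Openness and density of the generic locus -/

section GenericPolynomials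

variable {K : Type*} [Field K] {m n d : ℕ}

theorem MvPolynomial.IsHomogeneous.det {σ R : Type*} [CommRing R] {k e : ℕ}
    {A : Matrix (Fin k) (Fin k) (MvPolynomial σ R)} (h : ∀ i j, (A i j).IsHomogeneous e) :
    A.det.IsHomogeneous (k * e) := by
  rw [Matrix.det_apply']
  refine MvPolynomial.IsHomogeneous.sum _ _ _ fun s _ => ?_
  have h1 : (∏ i, A (s i) i).IsHomogeneous (∑ _i : Fin k, e) :=
    MvPolynomial.IsHomogeneous.prod _ _ _ fun i _ => h _ _
  rw [Finset.sum_const, Finset.card_univ, Fintype.card_fin, smul_eq_mul] at h1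
  rcases Int.units_eq_one_or (Equiv.Perm.sign s) with hs | hs
  · simpa [hs] using h1
  · simpa [hs] using h1.neg

theorem MvPolynomial.IsHomogeneous.eval_smul {σ R : Type*} [CommRing R] {f : MvPolynomial σ R}
    {N : ℕ} (hf : f.IsHomogeneous N) (c : R) (p : σ → R) :
    MvPolynomial.eval (c • p) f = c ^ N * MvPolynomial.eval p f := by
  rw [MvPolynomial.eval_eq, MvPolynomial.eval_eq, Finset.mul_sum]
  refine Finset.sum_congr rfl fun s hs => ?_
  have h1 := hf.degree_eq_sum_deg_support hs
  simp only [Pi.smul_apply, smul_eq_mul, mul_pow, Finset.prod_mul_distrib, Finset.prod_pow_eq_pow_sum]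
  rw [← h1]
  ring

/-- The determinant of the columns `J` of the matrix of concrete coordinates, over any
commutative ring. -/
def coordinateDet {R : Type*} [CommRing R] (W : Matrix (Fin (d + 1)) (Fin n) R)
    (J : Fin (d + 1) → SubsetsOfCard n d) : R :=
  (Matrix.of fun i l : Fin (d + 1) =>
    (W.submatrix i.succAbove ((J l).1.orderEmbOfFin (J l).2)).det).det

theorem coordinateDet_eq (W : Matrix (Fin (d + 1)) (Fin n) K)
    (J : Fin (d + 1) → SubsetsOfCard n d) :
    coordinateDet W J = ((concreteCoordinates W).submatrix id J).det := rfl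

theorem map_coordinateDet {R S : Type*} [CommRing R] [CommRing S] (φ : R →+* S)
    (W : Matrix (Fin (d + 1)) (Fin n) R) (J : Fin (d + 1) → SubsetsOfCard n d) :
    φ (coordinateDet W J) = coordinateDet (W.map φ) J := by
  rw [coordinateDet, RingHom.map_det, coordinateDet]
  congr 1
  ext i l
  simp [RingHom.map_det]
  rfl

/-- The maximal minor on the columns `I` of the generic matrix. -/
noncomputable def genericMinor (K : Type*) [Field K] (I : SubsetsOfCard n m) :
    MvPolynomial (Fin m × Fin n) K :=
  ((Matrix.mvPolynomialX (Fin m) (Fin n) K).submatrix id (I.1.orderEmbOfFin I.2)).det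

theorem eval_genericMinor (W : Matrix (Fin m) (Fin n) K) (I : SubsetsOfCard n m) :
    MvPolynomial.eval (fun p => W p.1 p.2) (genericMinor K I) = maxMinor W I := by
  rw [genericMinor, RingHom.map_det, maxMinor]
  congr 1
  ext i j
  simp [Matrix.mvPolynomialX]

theorem eval_aeval_genericMinor (W : Matrix (Fin m) (Fin n) K)
    (f : MvPolynomial (SubsetsOfCard n m) K) :
    MvPolynomial.eval (fun p => W p.1 p.2) (MvPolynomial.aeval (genericMinor K) f) =
      MvPolynomial.eval (maxMinor W) f := by
  induction f using MvPolynomial.induction_on with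
  | C a => simp
  | add p q hp hq => rw [map_add, map_add, map_add, hp, hq]
  | mul_X p i hp =>
    rw [map_mul, map_mul, map_mul, hp, MvPolynomial.aeval_X, eval_genericMinor,
      MvPolynomial.eval_X]

theorem eval_coordinateDet_mvPolynomialX (W : Matrix (Fin (d + 1)) (Fin n) K)
    (J : Fin (d + 1) → SubsetsOfCard n d) :
    MvPolynomial.eval (fun p => W p.1 p.2)
      (coordinateDet (Matrix.mvPolynomialX (Fin (d + 1)) (Fin n) K) J) =
      ((concreteCoordinates W).submatrix id J).det := by
  rw [map_coordinateDet, ← coordinateDet_eq]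
  congr 1
  ext i j
  simp [Matrix.mvPolynomialX]

theorem genericMinor_ne_zero (I : SubsetsOfCard n m) : genericMinor K I ≠ 0 := by
  intro h
  have h1 := eval_genericMinor
    (Matrix.of fun i j => if I.1.orderEmbOfFin I.2 i = j then (1 : K) else 0) I
  rw [h, map_zero, maxMinor] at h1
  have h2 : (Matrix.of fun i j => if I.1.orderEmbOfFin I.2 i = j then (1 : K) else 0).submatrix id
      (I.1.orderEmbOfFin I.2) = 1 := by
    ext i j
    simp [Matrix.one_apply]
  rw [h2, Matrix.det_one] at h1
  exact zero_ne_one h1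

theorem exists_ne_zero_of_mvPolynomial_ne_zero [Infinite K]
    {f : MvPolynomial (Fin m × Fin n) K} (hf : f ≠ 0) :
    ∃ W : Matrix (Fin m) (Fin n) K, MvPolynomial.eval (fun p => W p.1 p.2) f ≠ 0 := by
  by_contra! h
  refine hf (MvPolynomial.funext fun x => ?_)
  simpa using h (Matrix.of fun i j => x (i, j))

theorem coordinateDet_mvPolynomialX_ne_zero {X : Gr K (d + 1) n}
    {J : Fin (d + 1) → SubsetsOfCard n d} (h : MinorNonvanishing X J) :
    coordinateDet (Matrix.mvPolynomialX (Fin (d + 1)) (Fin n) K) J ≠ 0 := by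
  obtain ⟨W, hW⟩ := exists_isRowSpace X
  intro h0
  have h1 := eval_coordinateDet_mvPolynomialX W J
  rw [h0, map_zero] at h1
  exact h W hW h1.symm

/-- A minor on an arbitrary sequence of columns is a linear form in the Plücker coordinates. -/
theorem exists_linearForm_eval_maxMinor (f : Fin m → Fin n) :
    ∃ l : MvPolynomial (SubsetsOfCard n m) K, l.IsHomogeneous 1 ∧
      ∀ W : Matrix (Fin m) (Fin n) K, MvPolynomial.eval (maxMinor W) l =
        (W.submatrix id f).det := by
  classical
  by_cases hf : Function.Injective f
  -- Sorting the columns f into increasing order costs only the sign of a permutation; a repeated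
  -- column gives the form 0 below.
  · let I : SubsetsOfCard n m := ⟨Finset.univ.image f, by
      rw [Finset.card_image_of_injective _ hf]; simp⟩
    have h1 : ∀ i, ∃ j, I.1.orderEmbOfFin I.2 j = f i := fun i => by
      have : f i ∈ Set.range (I.1.orderEmbOfFin I.2) := by
        rw [Finset.range_orderEmbOfFin]; simp [I]
      exact this
    choose s hs using h1
    have hsinj : Function.Injective s := fun a b hab => hf (by rw [← hs a, ← hs b, hab])
    let e : Equiv.Perm (Fin m) := Equiv.ofBijective s (Finite.injective_iff_bijective.1 hsinj)
    refine ⟨MvPolynomial.C ((Equiv.Perm.sign e : ℤ) : K) * MvPolynomial.X I,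
      MvPolynomial.isHomogeneous_C_mul_X _ _, fun W => ?_⟩
    rw [map_mul, MvPolynomial.eval_C, MvPolynomial.eval_X, maxMinor, ← Matrix.det_permute']
    congr 1
    ext i j
    simp [e, hs]
  · refine ⟨0, MvPolynomial.isHomogeneous_zero _ _ _, fun W => ?_⟩
    rw [Function.Injective] at hf
    push Not at hf
    obtain ⟨a, b, hab, hne⟩ := hf
    rw [map_zero, Matrix.det_zero_of_column_eq hne]
    intro k
    simp [hab]

end GenericPolynomials

section Topology

variable {K : Type*} [Field K] {m n d : ℕ}

/-- The nonvanishing locus of a polynomial in the Plücker coordinates. -/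
def Gr.basicOpen (m n : ℕ) (f : MvPolynomial (SubsetsOfCard n m) K) : Set (Gr K m n) :=
  {X | ∀ p, IsPluckerVector X p → MvPolynomial.eval p f ≠ 0}

theorem Gr.isOpen_basicOpen {f : MvPolynomial (SubsetsOfCard n m) K} {N : ℕ}
    (hf : f.IsHomogeneous N) : IsOpen (Gr.basicOpen m n f) :=
  TopologicalSpace.isOpen_generateFrom_of_mem ⟨f, N, hf, rfl⟩

theorem Gr.mem_basicOpen_iff {f : MvPolynomial (SubsetsOfCard n m) K} {N : ℕ}
    (hf : f.IsHomogeneous N) {X : Gr K m n} {W : Matrix (Fin m) (Fin n) K}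
    (hW : IsRowSpace W X.1) :
    X ∈ Gr.basicOpen m n f ↔ MvPolynomial.eval (maxMinor W) f ≠ 0 := by
  constructor
  · intro h
    exact h _ ((isPluckerVector_iff hW _).2 ⟨1, one_ne_zero, by simp⟩)
  · intro h p hp
    obtain ⟨c, hc, rfl⟩ := (isPluckerVector_iff hW _).1 hp
    rw [hf.eval_smul]
    exact mul_ne_zero (pow_ne_zero _ hc) h

theorem Gr.isTopologicalBasis_basicOpen (K : Type*) [Field K] (m n : ℕ) :
    TopologicalSpace.IsTopologicalBasis
      {U | ∃ (f : MvPolynomial (SubsetsOfCard n m) K) (N : ℕ), f.IsHomogeneous N ∧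
        U = Gr.basicOpen m n f} := by
  have h := TopologicalSpace.isTopologicalBasis_of_subbasis_of_inter (α := Gr K m n)
    (r := {U | ∃ (f : MvPolynomial (SubsetsOfCard n m) K) (N : ℕ), f.IsHomogeneous N ∧
        U = Gr.basicOpen m n f}) rfl (by
      rintro _ ⟨f, N, hf, rfl⟩ _ ⟨g, M, hg, rfl⟩
      refine ⟨f * g, N + M, hf.mul hg, ?_⟩
      ext X
      simp only [Gr.basicOpen, Set.mem_inter_iff, Set.mem_ofPred_eq, map_mul, mul_ne_zero_iff]
      exact ⟨fun h p hp => ⟨h.1 p hp, h.2 p hp⟩,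
        fun h => ⟨fun p hp => (h p hp).1, fun p hp => (h p hp).2⟩⟩)
  convert h using 1
  ext U
  simp only [Set.mem_insert_iff]
  refine ⟨Or.inr, ?_⟩
  rintro (rfl | h)
  · refine ⟨1, 0, MvPolynomial.isHomogeneous_one _ _, ?_⟩
    ext X
    simp [Gr.basicOpen]
  · exact h

/-- On the chart p_I ≠ 0, the matrix adj(W_I) * W still has row space `X`, and by Cramer's rule its
(i, j) entry is the minor in which the i-th column of I is replaced by column j. Its entries are
thus linear in the Plücker coordinates, and so the minor of V is a homogeneous polynomial there. The
extra factor X_I restricts to the chart. -/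
theorem isOpen_setOf_minorNonvanishing (J : Fin (d + 1) → SubsetsOfCard n d) :
    IsOpen {X : Gr K (d + 1) n | MinorNonvanishing X J} := by
  choose l hl hlW using exists_linearForm_eval_maxMinor (K := K) (m := d + 1) (n := n)
  let Q : SubsetsOfCard n (d + 1) → Matrix (Fin (d + 1)) (Fin n)
      (MvPolynomial (SubsetsOfCard n (d + 1)) K) := fun I => Matrix.of fun i j =>
        l (Function.update (I.1.orderEmbOfFin I.2) i j)
  have hQ : ∀ I (W : Matrix (Fin (d + 1)) (Fin n) K), (Q I).map (MvPolynomial.eval (maxMinor W)) =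
      (W.submatrix id (I.1.orderEmbOfFin I.2)).adjugate * W := by
    intro I W
    ext i j
    have h1 : ((W.submatrix id (I.1.orderEmbOfFin I.2)).adjugate * W) i j =
        (W.submatrix id (I.1.orderEmbOfFin I.2)).cramer (fun k => W k j) i := by
      rw [Matrix.cramer_eq_adjugate_mulVec]
      rfl
    rw [h1, Matrix.cramer_apply]
    simp only [Q, Matrix.map_apply, Matrix.of_apply, hlW]
    congr 1
    ext a b
    by_cases hb : b = i
    · subst hb; simp
    · simp [hb]
  -- Degree 1 from X_I; then an outer determinant of size d + 1 whose entries are determinants of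
  -- size d in linear forms.
  have hhom : ∀ I, (MvPolynomial.X I * coordinateDet (Q I) J).IsHomogeneous
      (1 + (d + 1) * (d * 1)) := fun I =>
    (MvPolynomial.isHomogeneous_X _ _).mul
      (MvPolynomial.IsHomogeneous.det fun i j => MvPolynomial.IsHomogeneous.det fun _ _ => hl _)
  have hU : {X : Gr K (d + 1) n | MinorNonvanishing X J} =
      ⋃ I, Gr.basicOpen (d + 1) n (MvPolynomial.X I * coordinateDet (Q I) J) := by
    ext X
    obtain ⟨W, hW⟩ := exists_isRowSpace X
    simp only [Set.mem_ofPred_eq, Set.mem_iUnion, Gr.mem_basicOpen_iff (hhom _) hW,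
      minorNonvanishing_iff hW, map_mul, MvPolynomial.eval_X, map_coordinateDet, hQ,
      coordinateDet_eq, mul_ne_zero_iff]
    have hadj : ∀ I, maxMinor W I ≠ 0 →
        (W.submatrix id (I.1.orderEmbOfFin I.2)).adjugate.det ≠ 0 := fun I hI => by
      rw [Matrix.det_adjugate]
      exact pow_ne_zero _ hI
    constructor
    · intro h
      obtain ⟨I, hI⟩ := exists_maxMinor_ne_zero hW.linearIndependent
      refine ⟨I, hI, ?_⟩
      rw [det_concreteCoordinates_mul _ _ _ (hadj I hI)]
      exact mul_ne_zero (pow_ne_zero _ (hadj I hI)) h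
    · rintro ⟨I, hI, h⟩ h0
      rw [det_concreteCoordinates_mul _ _ _ (hadj I hI), h0, mul_zero] at h
      exact h rfl
  rw [hU]
  exact isOpen_iUnion fun I => Gr.isOpen_basicOpen (hhom I)

theorem isOpen_genericLocus : IsOpen (genericLocus K d n) := by
  have h : genericLocus K d n = ⋂ J : Fin (d + 1) → SubsetsOfCard n d,
      ⋂ _ : ∃ X' : Gr K (d + 1) n, MinorNonvanishing X' J, {X | MinorNonvanishing X J} := by
    ext X
    simp [genericLocus]
  rw [h]
  exact isOpen_iInter_of_finite fun J => isOpen_iInter_of_finite fun _ =>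
    isOpen_setOf_minorNonvanishing J

/-- Lift to the space of matrices: the pullback of the open set, one maximal minor (forcing full row
rank) and all relevant minors of V are nonzero polynomials, so their product is nonzero at some
matrix over an infinite field. -/
theorem dense_genericLocus [Infinite K] (hd : d < n) : Dense (genericLocus K d n) := by
  classical
  rw [(Gr.isTopologicalBasis_basicOpen K (d + 1) n).dense_iff]
  rintro _ ⟨f, N, hf, rfl⟩ ⟨X, hX⟩
  obtain ⟨T, hT⟩ := Finset.exists_subset_card_eq (s := (Finset.univ : Finset (Fin n)))
    (n := d + 1) (by simpa using hd)
  obtain ⟨W₀, hW₀⟩ := exists_isRowSpace X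
  let F : MvPolynomial (Fin (d + 1) × Fin n) K := MvPolynomial.aeval (genericMinor K) f
  have hF : ∀ W : Matrix (Fin (d + 1)) (Fin n) K,
      MvPolynomial.eval (fun p => W p.1 p.2) F = MvPolynomial.eval (maxMinor W) f := fun W =>
    eval_aeval_genericMinor W f
  have hF0 : F ≠ 0 := fun h0 => by
    have h1 := hF W₀
    rw [h0, map_zero] at h1
    exact (Gr.mem_basicOpen_iff hf hW₀).1 hX h1.symm
  -- Index tuples whose minor vanishes identically impose no condition and contribute the factor 1.
  let D : (Fin (d + 1) → SubsetsOfCard n d) → MvPolynomial (Fin (d + 1) × Fin n) K := fun J =>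
    if ∃ X' : Gr K (d + 1) n, MinorNonvanishing X' J then
      coordinateDet (Matrix.mvPolynomialX (Fin (d + 1)) (Fin n) K) J else 1
  have hD : ∀ J, D J ≠ 0 := fun J => by
    simp only [D]
    split_ifs with h
    · exact coordinateDet_mvPolynomialX_ne_zero h.choose_spec
    · exact one_ne_zero
  obtain ⟨W, hW⟩ := exists_ne_zero_of_mvPolynomial_ne_zero
    (mul_ne_zero (mul_ne_zero hF0 (genericMinor_ne_zero ⟨T, hT.2⟩))
      (Finset.prod_ne_zero_iff.2 fun J (_ : J ∈ Finset.univ) => hD J))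
  rw [map_mul, map_mul, mul_ne_zero_iff, mul_ne_zero_iff, hF, eval_genericMinor, map_prod,
    Finset.prod_ne_zero_iff] at hW
  have hli := linearIndependent_row_of_maxMinor_ne_zero hW.1.2
  have hrow := isRowSpace_grOfMatrix W hli
  refine ⟨grOfMatrix W hli, (Gr.mem_basicOpen_iff hf hrow).2 hW.1.1, fun J hJ => ?_⟩
  have h1 := hW.2 J (Finset.mem_univ _)
  simp only [D, if_pos hJ] at h1
  rw [eval_coordinateDet_mvPolynomialX] at h1
  exact (minorNonvanishing_iff hrow J).2 h1

end Topology

/-! ### The space `L(X)` as a row space -/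

section ConeAsRowSpace

variable {K : Type*} [Field K] {m n d : ℕ}

theorem mem_span_row_concreteCoordinates_iff (W : Matrix (Fin (d + 1)) (Fin n) K)
    (p : SubsetsOfCard n d → K) :
    p ∈ Submodule.span K (Set.range (concreteCoordinates W).row) ↔
      ∃ x, hyperplaneForm W x = p := by
  rw [← range_vecMulLinear, LinearMap.mem_range]
  constructor
  · rintro ⟨y, rfl⟩
    refine ⟨Matrix.vecMul y (signMatrix K d), ?_⟩
    rw [hyperplaneForm_eq_vecMul, Matrix.vecMul_vecMul, ← Matrix.mul_assoc, signMatrix_mul_self,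
      Matrix.one_mul, Matrix.vecMulLinear_apply]
  · rintro ⟨x, rfl⟩
    refine ⟨Matrix.vecMul x (signMatrix K d), ?_⟩
    rw [hyperplaneForm_eq_vecMul, Matrix.vecMulLinear_apply, Matrix.vecMul_vecMul]

theorem hyperplaneForm_single (W : Matrix (Fin (d + 1)) (Fin n) K) (i : Fin (d + 1)) :
    hyperplaneForm W (Pi.single i 1) =
      ((-1) ^ (i : ℕ) : K) • maxMinor (W.submatrix i.succAbove id) := by
  ext J
  rw [hyperplaneForm_eq_sum, Finset.sum_eq_single i]
  · simp [concreteCoordinates]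
  · intro j _ hj
    simp [hj]
  · simp

theorem spaceLCone_eq {X : Gr K (d + 1) n} {W : Matrix (Fin (d + 1)) (Fin n) K}
    (hW : IsRowSpace W X.1) :
    spaceLCone d X.1 = Submodule.span K (Set.range (concreteCoordinates W).row) := by
  ext p
  rw [SetLike.mem_coe, mem_span_row_concreteCoordinates_iff, spaceLCone, Set.mem_insert_iff]
  constructor
  · rintro (rfl | ⟨L, hLX, hp⟩)
    · exact ⟨0, by simp [hyperplaneForm_eq_vecMul]⟩
    · obtain ⟨M, c, hM, hc, rfl⟩ := hp
      obtain ⟨A, rfl⟩ := exists_eq_mul_of_span_le (M := W) (M' := M) (by rw [← hM, ← hW]; exact hLX)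
      have hA : LinearIndependent K A.row := by
        refine Matrix.vecMul_injective_iff.1 fun x y hxy => ?_
        refine Matrix.vecMul_injective_iff.2 hM.linearIndependent ?_
        simp only [← Matrix.vecMul_vecMul] at hxy ⊢
        rw [hxy]
      obtain ⟨a, ha⟩ : ∃ a, a ∉ Submodule.span K (Set.range A.row) := by
        by_contra! h
        have h1 : Submodule.span K (Set.range A.row) = ⊤ := eq_top_iff.2 fun x _ => h x
        have h2 := finrank_span_eq_card hA
        rw [h1] at h2
        simp at h2
      -- With a as row 0, deleting row 0 of g * W leaves A * W. The minors of A * W are therefore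
      -- det [e₀ | (gW)_J] = det g · det [g⁻¹e₀ | W_J].
      let g : Matrix (Fin (d + 1)) (Fin (d + 1)) K := Matrix.of (Fin.cons a A.row)
      have hg : IsUnit g := Matrix.linearIndependent_rows_iff_isUnit.1
        (linearIndependent_finCons.2 ⟨hA, ha⟩)
      have hgd : IsUnit g.det := (Matrix.isUnit_iff_isUnit_det g).1 hg
      have hsub : (g * W).submatrix (Fin.succAbove 0) id = A * W := by
        ext i j
        simp only [g, Matrix.submatrix_apply, Matrix.mul_apply, Fin.zero_succAbove, id_eq]
        rfl
      refine ⟨(c * g.det) • g⁻¹.mulVec (Pi.single 0 1), ?_⟩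
      have h1 : hyperplaneForm (g * W) (g.mulVec (g⁻¹.mulVec (Pi.single 0 1))) =
          maxMinor (A * W) := by
        rw [Matrix.mulVec_mulVec, Matrix.mul_nonsing_inv _ hgd, Matrix.one_mulVec,
          hyperplaneForm_single, hsub]
        simp
      ext J
      have h2 := congrFun h1 J
      rw [hyperplaneForm_mul] at h2
      rw [← h2, hyperplaneForm_eq_vecMul, Matrix.smul_vecMul, ← hyperplaneForm_eq_vecMul,
        Pi.smul_apply, smul_eq_mul, mul_assoc]
  · rintro ⟨x, rfl⟩
    by_cases hx : x = 0
    · left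
      simp [hx, hyperplaneForm_eq_vecMul]
    · right
      obtain ⟨i, hi⟩ := Function.ne_iff.1 hx
      -- This g sends e_i to x and has determinant x_i ≠ 0. The subspace sought is then spanned by
      -- the rows of g⁻¹ * W other than the i-th.
      let g : Matrix (Fin (d + 1)) (Fin (d + 1)) K := (1 : Matrix _ _ K).updateCol i x
      have hgd : g.det = x i := by
        rw [← Matrix.cramer_apply, Matrix.cramer_one]
        rfl
      have hgu : IsUnit g.det := by rw [hgd]; exact isUnit_iff_ne_zero.2 hi
      have hgi : g.mulVec (Pi.single i 1) = x := by
        ext j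
        simp [g]
      have hW' : IsRowSpace (g⁻¹ * W) X.1 := hW.mul (by
        rw [Matrix.det_nonsing_inv]
        simpa using hgu.ne_zero)
      have hli : LinearIndependent K ((g⁻¹ * W).submatrix i.succAbove id).row :=
        hW'.linearIndependent.comp _ Fin.succAbove_right_injective
      refine ⟨grOfMatrix _ hli, ?_, (isPluckerVector_iff (isRowSpace_grOfMatrix _ hli) _).2
        ⟨x i * (-1) ^ (i : ℕ), mul_ne_zero hi (by simp), ?_⟩⟩
      · rw [hW']
        refine Submodule.span_mono ?_
        rintro _ ⟨j, rfl⟩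
        exact ⟨i.succAbove j, rfl⟩
      · ext J
        have h1 := hyperplaneForm_mul g (g⁻¹ * W) (Pi.single i 1) J
        rw [hgi, ← Matrix.mul_assoc, Matrix.mul_nonsing_inv _ hgu, Matrix.one_mul,
          hyperplaneForm_single, hgd] at h1
        rw [h1]
        simp [mul_assoc]

end ConeAsRowSpace

/-! ### The matroid of a row space -/

section RowSpaceMatroid

variable {K ι E : Type*} [Field K]

/-- Evaluation of linear forms on the row space of `V` at the rows of `V`. -/
noncomputable def evalRows (V : Matrix ι E K) :
    Module.Dual K (Submodule.span K (Set.range V.row)) →ₗ[K] ι → K :=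
  LinearMap.pi fun i => Module.Dual.eval K _ ⟨V.row i, Submodule.subset_span ⟨i, rfl⟩⟩

theorem evalRows_injective (V : Matrix ι E K) : Function.Injective (evalRows V) := by
  rw [← LinearMap.ker_eq_bot, LinearMap.ker_eq_bot']
  intro φ hφ
  ext ⟨x, hx⟩
  induction hx using Submodule.span_induction with
  | mem x h =>
    obtain ⟨i, rfl⟩ := h
    exact congrFun hφ i
  | zero => exact map_zero φ
  | add x y hx hy h1 h2 =>
    have : (⟨x + y, add_mem hx hy⟩ : Submodule.span K (Set.range V.row)) = ⟨x, hx⟩ + ⟨y, hy⟩ := rfl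
    rw [this, map_add, h1, h2, map_add]
  | smul a x hx h =>
    have : (⟨a • x, Submodule.smul_mem _ a hx⟩ : Submodule.span K (Set.range V.row)) =
      a • ⟨x, hx⟩ := rfl
    rw [this, map_smul, h, map_smul]

variable [Finite E]

theorem subspaceMatroid_indep_iff (Y : Submodule K (E → K)) (I : Set E) :
    (subspaceMatroid Y).Indep I ↔ LinearIndepOn K
      (fun e : E => (LinearMap.proj e : (E → K) →ₗ[K] K).domRestrict Y) I := Iff.rfl

/-- The injective map `evalRows` sends the coordinate form of e to column e of V, so both families
satisfy the same linear relations. -/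
theorem subspaceMatroid_span_row_indep_iff (V : Matrix ι E K) (I : Set E) :
    (subspaceMatroid (Submodule.span K (Set.range V.row))).Indep I ↔ LinearIndepOn K V.col I := by
  rw [subspaceMatroid_indep_iff, ← LinearMap.linearIndepOn_iff_of_injOn (evalRows V)
    (evalRows_injective V).injOn]
  rfl

theorem mem_closure_subspaceMatroid_span_row_iff (V : Matrix ι E K) (S : Set E) (e : E) :
    e ∈ (subspaceMatroid (Submodule.span K (Set.range V.row))).closure S ↔
      V.col e ∈ Submodule.span K (V.col '' S) := by
  set M := subspaceMatroid (Submodule.span K (Set.range V.row)) with hM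
  obtain ⟨I, hI⟩ := M.exists_isBasis S (Set.subset_univ _)
  have key : ∀ f, f ∈ M.closure I ↔ V.col f ∈ Submodule.span K (V.col '' I) := by
    intro f
    have hIi := (subspaceMatroid_span_row_indep_iff V I).1 hI.indep
    rw [hI.indep.mem_closure_iff' ]
    by_cases hf : f ∈ I
    · exact ⟨fun _ => Submodule.subset_span ⟨f, hf, rfl⟩, fun _ => ⟨Set.mem_univ _, fun _ => hf⟩⟩
    · rw [subspaceMatroid_span_row_indep_iff, linearIndepOn_insert hf]
      constructor
      · rintro ⟨-, h⟩
        by_contra hn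
        exact hf (h ⟨hIi, hn⟩)
      · intro h
        exact ⟨Set.mem_univ _, fun h' => absurd h h'.2⟩
  rw [← hI.closure_eq_closure, key]
  have hspan : Submodule.span K (V.col '' I) = Submodule.span K (V.col '' S) := by
    refine le_antisymm (Submodule.span_mono (Set.image_mono hI.subset)) (Submodule.span_le.2 ?_)
    rintro _ ⟨s, hs, rfl⟩
    exact (key s).1 (hI.subset_closure hs)
  rw [hspan]

end RowSpaceMatroid

/-! ### Independence in the relabeled Dilworth truncation -/

section Dilworth

variable {n d : ℕ}

/-- The intersection of a family of subsets of `{0, …, n-1}`. -/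
def commonPart (S : Finset (SubsetsOfCard n d)) : Finset (Fin n) :=
  Finset.univ.filter fun a => ∀ J ∈ S, a ∈ J.1

theorem mem_commonPart {S : Finset (SubsetsOfCard n d)} {a : Fin n} :
    a ∈ commonPart S ↔ ∀ J ∈ S, a ∈ J.1 := by
  simp [commonPart]

theorem freeOn_univ_isFlat {α : Type*} (F : Set α) : (Matroid.freeOn Set.univ).IsFlat F := by
  rw [Matroid.isFlat_iff_closure_eq]; simp

theorem compl_coe_injective :
    Function.Injective fun J : SubsetsOfCard n d => ((J.1 : Set (Fin n)))ᶜ := by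
  intro J J' h
  exact Subtype.ext (Finset.coe_injective (compl_injective h))

theorem encard_compl_coe (T : Finset (Fin n)) :
    ((T : Set (Fin n))ᶜ).encard = ((n - T.card : ℕ) : ℕ∞) := by
  rw [← Finset.coe_compl, Set.encard_coe_eq_coe_finsetCard, Finset.card_compl, Fintype.card_fin]

/-- The union of the complements of the members of S is the complement of their intersection, so the
condition reads s + (n - d) ≤ (n - |⋂ S|) + 1. -/
theorem relabeledDilworth_indep_iff (hd : d < n) (I : Set (SubsetsOfCard n d)) :
    (relabeledDilworth n (n - d) d).Indep I ↔
      ∀ S : Finset (SubsetsOfCard n d), (S : Set (SubsetsOfCard n d)) ⊆ I → S.Nonempty →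
        S.card + (commonPart S).card ≤ d + 1 := by
  have hflat : ∀ J : SubsetsOfCard n d, (Matroid.freeOn (Set.univ : Set (Fin n))).IsFlat
      ((J.1 : Set (Fin n))ᶜ) ∧ (Matroid.freeOn (Set.univ : Set (Fin n))).eRk
      ((J.1 : Set (Fin n))ᶜ) = ((n - d : ℕ) : ℕ∞) := fun J => by
    refine ⟨freeOn_univ_isFlat _, ?_⟩
    rw [Matroid.eRk_freeOn (Set.subset_univ _), encard_compl_coe, J.2]
  have hU : ∀ S : Finset (SubsetsOfCard n d),
      ⋃₀ ((fun J : SubsetsOfCard n d => ((J.1 : Set (Fin n)))ᶜ) '' S) =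
        ((commonPart S : Finset (Fin n)) : Set (Fin n))ᶜ := fun S => by
    ext a
    simp [mem_commonPart]
  have hcond : ∀ S : Finset (SubsetsOfCard n d),
      ((((fun J : SubsetsOfCard n d => ((J.1 : Set (Fin n)))ᶜ) '' S).encard + ((n - d : ℕ) : ℕ∞) ≤
        (Matroid.freeOn (Set.univ : Set (Fin n))).eRk
          (⋃₀ ((fun J : SubsetsOfCard n d => ((J.1 : Set (Fin n)))ᶜ) '' S)) + 1) ↔
        S.card + (commonPart S).card ≤ d + 1) := fun S => by
    rw [hU, Matroid.eRk_freeOn (Set.subset_univ _), encard_compl_coe,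
      compl_coe_injective.encard_image, Set.encard_coe_eq_coe_finsetCard]
    have h := (commonPart S).card_le_univ
    rw [Fintype.card_fin] at h
    norm_cast
    omega
  have h0 : (relabeledDilworth n (n - d) d).Indep I ↔
      DilworthIndep (Matroid.freeOn (Set.univ : Set (Fin n))) (n - d)
        ((fun J : SubsetsOfCard n d => ((J.1 : Set (Fin n)))ᶜ) '' I) := by
    rw [relabeledDilworth, Matroid.comap_indep_iff, and_iff_left compl_coe_injective.injOn]
    rfl
  rw [h0]
  constructor
  · rintro ⟨-, h⟩ S hS hne
    exact (hcond S).1 (h _ (Set.image_mono hS) (by simpa using hne))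
  · intro h
    refine ⟨?_, fun S hS hne => ?_⟩
    · rintro _ ⟨J, -, rfl⟩
      exact hflat J
    · obtain ⟨S', hS', rfl⟩ := Set.subset_image_iff.1 hS
      obtain ⟨S', rfl⟩ := (Set.toFinite S').exists_finset_coe
      exact (hcond S').2 (h S' hS' (by simpa using hne))

theorem relabeledDilworth_ground (hd : d < n) : (relabeledDilworth n (n - d) d).E = Set.univ := by
  refine Set.eq_univ_of_forall fun J => ?_
  have h : (relabeledDilworth n (n - d) d).Indep {J} := by
    rw [relabeledDilworth_indep_iff hd]
    intro S hS hne
    obtain rfl : S = {J} := by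
      rw [← Finset.coe_inj, Finset.coe_singleton]
      exact (Set.subset_singleton_iff_eq.1 hS).resolve_left (by simpa using hne.ne_empty)
    have : commonPart {J} = J.1 := by ext a; simp [mem_commonPart]
    rw [this, J.2, Finset.card_singleton, add_comm]
  exact h.subset_ground rfl

/-- The `d`-element subsets of a fixed set of `d + 1` elements form an independent set of
`d + 1` elements. -/
theorem exists_relabeledDilworth_indep (hd : d < n) :
    ∃ I, (relabeledDilworth n (n - d) d).Indep I ∧ I.encard = ((d + 1 : ℕ) : ℕ∞) := by
  classical
  obtain ⟨T, -, hT⟩ := Finset.exists_subset_card_eq (s := (Finset.univ : Finset (Fin n)))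
    (n := d + 1) (by simpa using hd)
  let f : T → SubsetsOfCard n d := fun t => ⟨T.erase t.1, by
    rw [Finset.card_erase_of_mem t.2, hT]; rfl⟩
  have hf : Function.Injective f := by
    intro a b hab
    have h : T.erase a.1 = T.erase b.1 := congrArg Subtype.val hab
    exact Subtype.ext (Finset.erase_injOn T a.2 b.2 h)
  refine ⟨Set.range f, ?_, ?_⟩
  · rw [relabeledDilworth_indep_iff hd]
    intro S hS hne
    let S' : Finset T := Finset.univ.filter fun t => f t ∈ S
    have hS' : S = S'.image f := by
      ext J
      simp only [S', Finset.mem_image, Finset.mem_filter, Finset.mem_univ, true_and]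
      constructor
      · intro hJ
        obtain ⟨t, rfl⟩ := hS hJ
        exact ⟨t, hJ, rfl⟩
      · rintro ⟨t, ht, rfl⟩
        exact ht
    -- The members of S are T minus t for t in S', so no such t lies in their intersection: S' and
    -- the common part are disjoint inside T, which has d + 1 elements.
    have hdis : Disjoint (S'.image Subtype.val) (commonPart S) := by
      rw [Finset.disjoint_left]
      intro a ha ha'
      obtain ⟨t, ht, rfl⟩ := Finset.mem_image.1 ha
      have h := mem_commonPart.1 ha' (f t) (Finset.mem_filter.1 ht).2
      simp [f] at h
    have hsub : S'.image Subtype.val ∪ commonPart S ⊆ T := by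
      refine Finset.union_subset ?_ ?_
      · intro a ha
        obtain ⟨t, -, rfl⟩ := Finset.mem_image.1 ha
        exact t.2
      · intro a ha
        obtain ⟨J, hJ⟩ := hne
        obtain ⟨t, rfl⟩ := hS hJ
        exact Finset.mem_of_mem_erase (mem_commonPart.1 ha _ hJ)
    have h1 := Finset.card_le_card hsub
    rw [Finset.card_union_of_disjoint hdis, Finset.card_image_of_injective _ Subtype.val_injective,
      hT] at h1
    have h2 : S.card = S'.card := by rw [hS', Finset.card_image_of_injective _ hf]
    omega
  · rw [← Set.image_univ, hf.encard_image, Set.encard_univ]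
    simp [hT]

end Dilworth

/-! ### The matroid of `L(X)` -/

section MatroidOfL

variable {K : Type*} [Field K] {n d : ℕ}

theorem hyperplaneForm_col_eq_zero (W : Matrix (Fin (d + 1)) (Fin n) K) {J : SubsetsOfCard n d}
    {a : Fin n} (ha : a ∈ J.1) : hyperplaneForm W (W.col a) J = 0 := by
  have h : a ∈ Set.range (J.1.orderEmbOfFin J.2) := by
    rw [Finset.range_orderEmbOfFin]; exact ha
  obtain ⟨j, rfl⟩ := h
  exact Matrix.det_zero_of_column_eq (Fin.succ_ne_zero j).symm fun i => by
    simp [borderedMatrix, Matrix.col]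

/-- The normals indexed by S annihilate the columns of `W` in the common part. With the normals as
rows of A and those columns as columns of B, A * B = 0, so the ranks add up to at most d + 1; both
ranks are full. -/
theorem card_add_card_commonPart_le {W : Matrix (Fin (d + 1)) (Fin n) K}
    {S : Finset (SubsetsOfCard n d)} (hS : S.Nonempty)
    (h : LinearIndepOn K (concreteCoordinates W).col S) :
    S.card + (commonPart S).card ≤ d + 1 := by
  set U := signMatrix K d * concreteCoordinates W with hU
  have hUli : LinearIndepOn K U.col S := by
    have h1 : U.col = (signMatrix K d).mulVecLin ∘ (concreteCoordinates W).col := by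
      ext J i
      rfl
    rw [h1]
    refine (LinearMap.linearIndepOn_iff_of_injOn _ (Function.Injective.injOn ?_)).2 h
    intro x y hxy
    have := congrArg (signMatrix K d).mulVec hxy
    simpa [Matrix.mulVec_mulVec, signMatrix_mul_self] using this
  let A : Matrix S (Fin (d + 1)) K := Matrix.of fun J => U.col J.1
  let B : Matrix (Fin (d + 1)) (commonPart S) K := W.submatrix id Subtype.val
  have hAB : A * B = 0 := by
    ext J a
    have h1 := hyperplaneForm_col_eq_zero W (mem_commonPart.1 a.2 J.1 J.2)
    rw [hyperplaneForm_eq_vecMul] at h1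
    rw [Matrix.zero_apply, ← h1]
    simp only [A, B, hU, Matrix.mul_apply, Matrix.vecMul, dotProduct, Matrix.of_apply, Matrix.col,
      Matrix.submatrix_apply, id_eq, Matrix.transpose_apply]
    exact Finset.sum_congr rfl fun i _ => mul_comm _ _
  have hA : A.rank = S.card := by
    have h1 : LinearIndependent K A.row := hUli
    simpa using h1.rank_matrix
  -- A nonzero normal for a single J in S means det [e_i | W_J] ≠ 0 for some i. So the columns of
  -- `W` in J, and hence those in the common part, are independent.
  have hB : B.rank = (commonPart S).card := by
    obtain ⟨J, hJ⟩ := hS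
    have h1 : U.col J ≠ 0 := hUli.ne_zero hJ
    obtain ⟨i, hi⟩ := Function.ne_iff.1 h1
    have h2 : hyperplaneForm W (Pi.single i 1) J ≠ 0 := by
      rw [hyperplaneForm_eq_vecMul, Matrix.single_one_vecMul]
      exact hi
    have h3 := (Matrix.linearIndependent_cols_of_det_ne_zero h2)
    have h4 : ∀ a : commonPart S, ∃ j, J.1.orderEmbOfFin J.2 j = a.1 := fun a => by
      have : a.1 ∈ Set.range (J.1.orderEmbOfFin J.2) := by
        rw [Finset.range_orderEmbOfFin]; exact mem_commonPart.1 a.2 J hJ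
      exact this
    choose j hj using h4
    have h5 : LinearIndependent K B.col := by
      have h6 := h3.comp (fun a => (j a).succ) (fun a b hab => by
        have : j a = j b := Fin.succ_injective _ hab
        exact Subtype.ext (by rw [← hj a, ← hj b, this]))
      have h7 : B.col = (borderedMatrix W (Pi.single i 1) J).col ∘ fun a => (j a).succ := by
        ext a l
        change W l a.1 = W l (J.1.orderEmbOfFin J.2 (j a))
        rw [hj]
      rw [h7]
      exact h6
    rw [← Matrix.rank_transpose]
    have h7 : LinearIndependent K B.transpose.row := h5
    simpa using h7.rank_matrix
  have := Matrix.rank_add_rank_le_card_of_mul_eq_zero hAB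
  rwa [hA, hB, Fintype.card_fin] at this

/-- By Hall's theorem, a generic matrix whose `i`-th row vanishes on the columns in `J i` has
invertible complementary minors. -/
theorem coordinateDet_mvPolynomialX_ne_zero_of_hall (J : Fin (d + 1) → SubsetsOfCard n d)
    (hJ : Function.Injective J)
    (h : ∀ S : Finset (SubsetsOfCard n d), (S : Set (SubsetsOfCard n d)) ⊆ Set.range J →
      S.Nonempty → S.card + (commonPart S).card ≤ d + 1) :
    coordinateDet (Matrix.mvPolynomialX (Fin (d + 1)) (Fin n) K) J ≠ 0 := by
  classical
  let P : Matrix (Fin (d + 1)) (Fin n) (MvPolynomial (Fin (d + 1) × Fin n) K) :=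
    Matrix.of fun i a => if a ∈ (J i).1 then 0 else MvPolynomial.X (i, a)
  have hdiag : ∀ i, (P.submatrix i.succAbove ((J i).1.orderEmbOfFin (J i).2)).det ≠ 0 := by
    intro i
    -- A matching of the rows other than i with columns in J_i at which they do not vanish. Hall's
    -- condition holds because the union over s misses only the common part of J_i and the chosen
    -- sets; these are |s| + 1 sets, so at most d - |s| of the d elements of J_i are missed.
    obtain ⟨f, hf, hfm⟩ := (Finset.all_card_le_biUnion_card_iff_exists_injective
      (fun r : Fin d => (J i).1 \ (J (i.succAbove r)).1)).1 (by
        intro s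
        rcases s.eq_empty_or_nonempty with rfl | hs
        · simp
        let S : Finset (SubsetsOfCard n d) := insert (J i) (s.image fun r => J (i.succAbove r))
        have hScard : S.card = s.card + 1 := by
          rw [Finset.card_insert_of_notMem, Finset.card_image_of_injective]
          · exact hJ.comp Fin.succAbove_right_injective
          · simp only [Finset.mem_image, not_exists, not_and]
            exact fun r _ hr => Fin.succAbove_ne i r (hJ hr)
        have hS := h S (by
          intro x hx
          rcases Finset.mem_insert.1 (Finset.mem_coe.1 hx) with rfl | hx
          · exact ⟨i, rfl⟩
          · obtain ⟨r, -, rfl⟩ := Finset.mem_image.1 hx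
            exact ⟨_, rfl⟩) ⟨_, Finset.mem_insert_self _ _⟩
        have hcover : (J i).1 ⊆
            (s.biUnion fun r : Fin d => (J i).1 \ (J (i.succAbove r)).1) ∪ commonPart S := by
          intro a ha
          rw [Finset.mem_union]
          by_cases hc : a ∈ commonPart S
          · exact Or.inr hc
          · left
            rw [mem_commonPart] at hc
            push Not at hc
            obtain ⟨x, hx, hax⟩ := hc
            rcases Finset.mem_insert.1 hx with rfl | hx
            · exact absurd ha hax
            · obtain ⟨r, hr, rfl⟩ := Finset.mem_image.1 hx
              exact Finset.mem_biUnion.2 ⟨r, hr, Finset.mem_sdiff.2 ⟨ha, hax⟩⟩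
        have h1 := (Finset.card_le_card hcover).trans (Finset.card_union_le _ _)
        rw [(J i).2] at h1
        omega)
    have h4 : ∀ r, ∃ c, (J i).1.orderEmbOfFin (J i).2 c = f r := fun r => by
      have : f r ∈ Set.range ((J i).1.orderEmbOfFin (J i).2) := by
        rw [Finset.range_orderEmbOfFin]; exact (Finset.mem_sdiff.1 (hfm r)).1
      exact this
    choose e he using h4
    have heinj : Function.Injective e := fun a b hab => hf (by rw [← he a, ← he b, hab])
    let σ : Equiv.Perm (Fin d) := Equiv.ofBijective e (Finite.injective_iff_bijective.1 heinj)
    intro h0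
    -- Evaluating at the indicator of the matching turns the submatrix into a permutation matrix.
    let x : Fin (d + 1) × Fin n → K := fun p =>
      if ∃ r, p.1 = i.succAbove r ∧ p.2 = f r then 1 else 0
    have h1 := congrArg (MvPolynomial.eval x) h0
    rw [RingHom.map_det, map_zero] at h1
    have h2 : (MvPolynomial.eval x).mapMatrix
        (P.submatrix i.succAbove ((J i).1.orderEmbOfFin (J i).2)) = σ.permMatrix K := by
      ext r c
      have hiff : (∃ r', i.succAbove r = i.succAbove r' ∧
          (J i).1.orderEmbOfFin (J i).2 c = f r') ↔ σ r = c := by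
        constructor
        · rintro ⟨r', hr, hc⟩
          obtain rfl := Fin.succAbove_right_injective hr
          rw [← he] at hc
          exact ((J i).1.orderEmbOfFin (J i).2).injective hc.symm
        · rintro rfl
          exact ⟨r, rfl, he r⟩
      rw [RingHom.mapMatrix_apply, Matrix.map_apply, Matrix.submatrix_apply, Equiv.Perm.permMatrix,
        PEquiv.toMatrix_apply, Equiv.toPEquiv_apply]
      simp only [Option.mem_some_iff]
      simp only [P, Matrix.of_apply]
      by_cases hc : σ r = c
      · have hnot : (J i).1.orderEmbOfFin (J i).2 c ∉ (J (i.succAbove r)).1 := by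
          rw [← hc]
          have := (Finset.mem_sdiff.1 (hfm r)).2
          rwa [← he r] at this
        rw [if_neg hnot, MvPolynomial.eval_X, if_pos hc]
        exact if_pos (hiff.2 hc)
      · rw [if_neg hc]
        split_ifs
        · simp
        · rw [MvPolynomial.eval_X]
          exact if_neg fun hh => hc (hiff.1 hh)
    rw [h2, Matrix.det_permutation] at h1
    rcases Int.units_eq_one_or (Equiv.Perm.sign σ) with hs | hs <;> simp [hs] at h1
  have hP : coordinateDet P J ≠ 0 := by
    -- For i ≠ l, row l survives the deletion of row i and vanishes on J_l, so the off-diagonal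
    -- entries are 0.
    have h1 : (Matrix.of fun i l : Fin (d + 1) =>
        (P.submatrix i.succAbove ((J l).1.orderEmbOfFin (J l).2)).det) =
        Matrix.diagonal fun i => (P.submatrix i.succAbove ((J i).1.orderEmbOfFin (J i).2)).det := by
      ext1 i l
      by_cases hil : i = l
      · subst hil; simp
      · rw [Matrix.diagonal_apply_ne _ hil, Matrix.of_apply]
        obtain ⟨r, hr⟩ := Fin.exists_succAbove_eq (Ne.symm hil)
        refine Matrix.det_eq_zero_of_row_eq_zero r fun c => ?_
        rw [Matrix.submatrix_apply, hr]
        exact if_pos (Finset.orderEmbOfFin_mem _ _ _)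
    rw [coordinateDet, h1, Matrix.det_diagonal]
    exact Finset.prod_ne_zero_iff.2 fun i _ => hdiag i
  intro h0
  -- The generic matrix specializes to P, so its minor cannot be 0 if that of P is not.
  let φ : MvPolynomial (Fin (d + 1) × Fin n) K →+* MvPolynomial (Fin (d + 1) × Fin n) K :=
    (MvPolynomial.aeval fun p : Fin (d + 1) × Fin n => P p.1 p.2).toRingHom
  have h1 := map_coordinateDet φ (Matrix.mvPolynomialX (Fin (d + 1)) (Fin n) K) J
  have h2 : (Matrix.mvPolynomialX (Fin (d + 1)) (Fin n) K).map φ = P := by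
    ext1 i a
    simp [φ, Matrix.mvPolynomialX]
  rw [h0, map_zero, h2] at h1
  exact hP h1.symm

theorem exists_minorNonvanishing [Infinite K] (hd : d < n) {J : Fin (d + 1) → SubsetsOfCard n d}
    (h : coordinateDet (Matrix.mvPolynomialX (Fin (d + 1)) (Fin n) K) J ≠ 0) :
    ∃ X : Gr K (d + 1) n, MinorNonvanishing X J := by
  obtain ⟨T, hT⟩ := Finset.exists_subset_card_eq (s := (Finset.univ : Finset (Fin n)))
    (n := d + 1) (by simpa using hd)
  obtain ⟨W, hW⟩ := exists_ne_zero_of_mvPolynomial_ne_zero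
    (mul_ne_zero h (genericMinor_ne_zero ⟨T, hT.2⟩))
  rw [map_mul, mul_ne_zero_iff, eval_genericMinor, eval_coordinateDet_mvPolynomialX] at hW
  exact ⟨grOfMatrix W (linearIndependent_row_of_maxMinor_ne_zero hW.2),
    (minorNonvanishing_iff (isRowSpace_grOfMatrix W _) J).2 hW.1⟩

theorem span_spaceLCone {X : Gr K (d + 1) n} {W : Matrix (Fin (d + 1)) (Fin n) K}
    (hW : IsRowSpace W X.1) : Submodule.span K (spaceLCone d X.1) =
      Submodule.span K (Set.range (concreteCoordinates W).row) := by
  rw [spaceLCone_eq hW, Submodule.span_eq]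

/-- Genericity speaks only of maximal minors, so a Dilworth-independent set is first enlarged to a
base. The explicit independent set gives a base at least d + 1 elements, and the Dilworth inequality
at most d + 1. -/
theorem matroidOfL_eq_relabeledDilworth [Infinite K] (hd : d < n) {X : Gr K (d + 1) n}
    (hX : X ∈ genericLocus K d n) : matroidOfL d X.1 = relabeledDilworth n (n - d) d := by
  obtain ⟨W, hW⟩ := exists_isRowSpace X
  rw [matroidOfL, span_spaceLCone hW]
  refine Matroid.ext_indep (by rw [relabeledDilworth_ground hd]; rfl) fun I _ => ?_
  rw [subspaceMatroid_span_row_indep_iff]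
  constructor
  · intro h
    rw [relabeledDilworth_indep_iff hd]
    exact fun S hS hne => card_add_card_commonPart_le hne (h.mono hS)
  · intro h
    obtain ⟨B, hB, hIB⟩ := h.exists_isBase_superset
    refine LinearIndepOn.mono ?_ hIB
    obtain ⟨B, rfl⟩ := (Set.toFinite B).exists_finset_coe
    have hBi := (relabeledDilworth_indep_iff hd _).1 hB.indep
    obtain ⟨I₀, hI₀, hcard⟩ := exists_relabeledDilworth_indep hd
    have h1 : d + 1 ≤ B.card := by
      have := hI₀.encard_le_eRank
      rw [← hB.encard_eq_eRank, hcard, Set.encard_coe_eq_coe_finsetCard] at this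
      exact_mod_cast this
    have hBne : B.Nonempty := Finset.card_pos.1 (by omega)
    have h2 : B.card = d + 1 := by
      have := hBi B subset_rfl hBne
      omega
    let J : Fin (d + 1) → SubsetsOfCard n d := fun i => ((B.equivFinOfCardEq h2).symm i).1
    have hJ : Function.Injective J :=
      Subtype.val_injective.comp (B.equivFinOfCardEq h2).symm.injective
    have hJr : Set.range J = B := by
      simp only [J]
      rw [Set.range_comp' Subtype.val, (B.equivFinOfCardEq h2).symm.surjective.range_eq]
      simp
    rw [← hJr] at hBi ⊢
    have h3 := (minorNonvanishing_iff hW J).1 (hX J (exists_minorNonvanishing hd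
      (coordinateDet_mvPolynomialX_ne_zero_of_hall J hJ hBi)))
    rw [linearIndepOn_range_iff hJ]
    exact Matrix.linearIndependent_cols_of_det_ne_zero h3

end MatroidOfL

/-! ### Bergman fans through closures -/

section Bergman

variable {E : Type*}

/-- The weights all of whose sublevel sets are flats of `M`. -/
def FlatSublevels {R : Type*} [LE R] (M : Matroid E) (w : E → R) : Prop :=
  ∀ (S : Set E) (e : E), e ∈ M.closure S → ∃ s ∈ S, w e ≤ w s

theorem FlatSublevels.loopless {R : Type*} [LE R] {M : Matroid E} {w : E → R}
    (h : FlatSublevels M w) : M.Loopless := by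
  rw [Matroid.loopless_iff, Set.eq_empty_iff_forall_notMem]
  intro e he
  obtain ⟨s, hs, -⟩ := h ∅ e he
  exact hs

/-- An arbitrary down-set P covers both closed sublevel sets of real weights and strict superlevel
sets of integer weights, the latter through the order dual. -/
theorem FlatSublevels.isFlat {R : Type*} [LE R] {M : Matroid E} (hE : M.E = Set.univ) {w : E → R}
    (h : FlatSublevels M w) {P : R → Prop} (hP : ∀ a b, a ≤ b → P b → P a) :
    M.IsFlat {e | P (w e)} := by
  rw [Matroid.isFlat_iff_closure_eq]
  refine subset_antisymm (fun e he => ?_) (M.subset_closure _ (by rw [hE]; exact subset_univ _))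
  obtain ⟨s, hs, hle⟩ := h _ e he
  exact hP _ _ hle hs

theorem isClosed_flatSublevels [Finite E] (M : Matroid E) :
    IsClosed {w : E → ℝ | FlatSublevels M w} := by
  have h : {w : E → ℝ | FlatSublevels M w} =
      ⋂ (S : Set E) (e : E) (_ : e ∈ M.closure S), ⋃ s ∈ S, {w | w e ≤ w s} := by
    ext w
    simp [FlatSublevels]
  rw [h]
  exact isClosed_iInter fun S => isClosed_iInter fun e => isClosed_iInter fun _ =>
    (Set.toFinite S).isClosed_biUnion fun s _ =>
      isClosed_le (continuous_apply e) (continuous_apply s)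

/-- Let g a be the gap from a to the next larger element of `insert m A`; the sum telescopes from b
up to m. -/
theorem exists_increments (A : Finset ℝ) {m : ℝ} (hm : ∀ a ∈ A, a < m) :
    ∃ g : ℝ → ℝ, (∀ a ∈ A, 0 ≤ g a) ∧
      ∀ b ∈ insert m A, b = m - ∑ a ∈ A with b ≤ a, g a := by
  induction A using Finset.induction_on_min with
  | empty => exact ⟨0, by simp, by simp⟩
  | insert a A ha ih =>
    obtain ⟨g, hg, hsum⟩ := ih fun x hx => hm x (Finset.mem_insert_of_mem hx)
    have haA : a ∉ A := fun h => lt_irrefl _ (ha a h)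
    have hne : (insert m A).Nonempty := Finset.insert_nonempty _ _
    set m' := (insert m A).min' hne with hm'
    have hlt : ∀ x ∈ insert m A, a < x := fun x hx => by
      rcases Finset.mem_insert.1 hx with rfl | hx
      · exact hm a (Finset.mem_insert_self _ _)
      · exact ha x hx
    have ham' : a < m' := hlt _ (Finset.min'_mem _ _)
    have hupd : ∀ x ∈ A, Function.update g a (m' - a) x = g x := fun x hx =>
      Function.update_of_ne (ha x hx).ne' _ _
    refine ⟨Function.update g a (m' - a), ?_, ?_⟩
    · intro x hx
      rcases Finset.mem_insert.1 hx with rfl | hx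
      · rw [Function.update_self]; linarith
      · rw [hupd x hx]; exact hg x hx
    · have hold : ∀ b ∈ insert m A,
          b = m - ∑ x ∈ insert a A with b ≤ x, Function.update g a (m' - a) x := by
        intro b hb
        rw [Finset.filter_insert, if_neg (not_le.2 (hlt b hb)),
          Finset.sum_congr rfl fun x hx => hupd x (Finset.mem_filter.1 hx).1]
        exact hsum b hb
      intro b hb
      rw [Finset.mem_insert, Finset.mem_insert] at hb
      rcases hb with rfl | rfl | hb
      · exact hold _ (Finset.mem_insert_self _ _)
      · have h1 : (insert b A).filter (fun x => b ≤ x) = insert b A := by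
          refine Finset.filter_true_of_mem fun x hx => ?_
          rcases Finset.mem_insert.1 hx with rfl | hx
          · exact le_rfl
          · exact (ha x hx).le
        have h2 := hsum m' (Finset.min'_mem _ _)
        have h3 : A.filter (fun x => m' ≤ x) = A :=
          Finset.filter_true_of_mem fun x hx =>
            Finset.min'_le _ _ (Finset.mem_insert_of_mem hx)
        rw [h3] at h2
        rw [h1, Finset.sum_insert haA, Function.update_self, Finset.sum_congr rfl hupd]
        linarith
      · exact hold _ (Finset.mem_insert_of_mem hb)

theorem mk_eq_mk_iff {w w' : E → ℝ} :
    (Submodule.Quotient.mk w : TropicalTorus E) = Submodule.Quotient.mk w' ↔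
      ∃ t : ℝ, ∀ e, w e = w' e + t := by
  rw [Submodule.Quotient.eq, Submodule.mem_span_singleton]
  constructor
  · rintro ⟨t, ht⟩
    refine ⟨t, fun e => ?_⟩
    have := congrFun ht e
    simp at this
    linarith
  · rintro ⟨t, ht⟩
    refine ⟨t, ?_⟩
    ext e
    simp [ht e]

theorem sum_smul_neg_indicator_apply (C : Finset (Set E)) (c : Set E → ℝ) (e : E)
    [DecidablePred fun F : Set E => e ∈ F] :
    (∑ F ∈ C, c F • -(F.indicator (1 : E → ℝ))) e = -∑ F ∈ C with e ∈ F, c F := by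
  rw [Finset.sum_apply, Finset.sum_filter, ← Finset.sum_neg_distrib]
  refine Finset.sum_congr rfl fun F _ => ?_
  by_cases h : e ∈ F <;> simp [h]

/-- On a cone, the weight of e is a constant minus the coefficients of the chain members containing
e. If e outweighed all of S, each s in S would lie in a member avoiding e; the largest member
avoiding e is then a flat containing S, hence the closure of S, hence e. Conversely, the sublevel
sets of w form the chain, with the gaps between consecutive values as coefficients. -/
theorem mk_mem_bergmanFan_iff [Finite E] {M : Matroid E} (hE : M.E = Set.univ) (w : E → ℝ) :
    (Submodule.Quotient.mk w : TropicalTorus E) ∈ bergmanFan M ↔ FlatSublevels M w := by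
  classical
  constructor
  · rintro ⟨hl, C, hC, hchain, c, hc, hx⟩ S e he
    obtain ⟨t, ht⟩ := mk_eq_mk_iff.1 hx
    by_contra! hcon
    have hw : ∀ e, w e = t - ∑ F ∈ C with e ∈ F, c F := fun e => by
      rw [ht e, sum_smul_neg_indicator_apply]; ring
    have hsep : ∀ s ∈ S, ∃ F ∈ C, s ∈ F ∧ e ∉ F := by
      intro s hs
      by_contra! h
      have h1 := hcon s hs
      rw [hw, hw] at h1
      have h2 : ∑ F ∈ C with s ∈ F, c F ≤ ∑ F ∈ C with e ∈ F, c F :=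
        Finset.sum_le_sum_of_subset_of_nonneg
          (fun F hF => by
            rw [Finset.mem_filter] at hF ⊢
            exact ⟨hF.1, h F hF.1 hF.2⟩)
          fun F hF _ => hc F (Finset.mem_filter.1 hF).1
      linarith
    have hSne : S.Nonempty := by
      rw [Set.nonempty_iff_ne_empty]
      rintro rfl
      have h1 := (M.loopless_iff).1 hl
      exact Set.notMem_empty e (h1 ▸ he)
    obtain ⟨s₀, hs₀⟩ := hSne
    obtain ⟨F₀, hF₀C, -, hF₀⟩ := hsep s₀ hs₀
    obtain ⟨G, hG⟩ := (C.filter fun F => e ∉ F).exists_maximal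
      ⟨F₀, Finset.mem_filter.2 ⟨hF₀C, hF₀⟩⟩
    obtain ⟨hGC, heG⟩ := Finset.mem_filter.1 hG.prop
    have hSG : S ⊆ G := by
      intro s hs
      obtain ⟨F, hFC, hsF, heF⟩ := hsep s hs
      rcases hchain.total hFC hGC with h | h
      · exact h hsF
      · exact hG.le_of_ge (Finset.mem_filter.2 ⟨hFC, heF⟩) h hsF
    have h1 := M.closure_subset_closure hSG he
    rw [(hC G hGC).1.closure] at h1
    exact heG h1
  · intro h
    refine ⟨h.loopless, ?_⟩
    rcases isEmpty_or_nonempty E with hemp | hne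
    · exact ⟨∅, by simp, by simp, 0, by simp, congrArg _ (Subsingleton.elim _ _)⟩
    have := Fintype.ofFinite E
    obtain ⟨e₀, he₀⟩ := Finite.exists_max w
    -- The maximal value is dropped: its sublevel set is the whole ground set, and it only
    -- contributes a multiple of the all-ones vector.
    let A : Finset ℝ := (Finset.univ.image w).erase (w e₀)
    have hA : ∀ a ∈ A, a < w e₀ := fun a ha => by
      obtain ⟨hne, ha⟩ := Finset.mem_erase.1 ha
      obtain ⟨e, -, rfl⟩ := Finset.mem_image.1 ha
      exact lt_of_le_of_ne (he₀ e) hne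
    have hAw : ∀ a ∈ A, ∃ e, w e = a := fun a ha => by
      obtain ⟨e, -, he⟩ := Finset.mem_image.1 (Finset.mem_erase.1 ha).2
      exact ⟨e, he⟩
    obtain ⟨g, hg, hsum⟩ := exists_increments A hA
    let Φ : ℝ → Set E := fun a => {e | w e ≤ a}
    have hΦmono : Monotone Φ := fun a b hab e (he : w e ≤ a) => le_trans he hab
    have hΦinj : Set.InjOn Φ A := by
      intro a ha b hb hab
      obtain ⟨e, rfl⟩ := hAw a ha
      obtain ⟨f, rfl⟩ := hAw b hb
      have h1 : e ∈ Φ (w f) := hab ▸ (le_refl (w e) : e ∈ Φ (w e))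
      have h2 : f ∈ Φ (w e) := hab ▸ (le_refl (w f) : f ∈ Φ (w f))
      exact le_antisymm h1 h2
    have hinv : ∀ a ∈ A, Function.invFunOn Φ (A : Set ℝ) (Φ a) = a := fun a ha =>
      hΦinj.leftInvOn_invFunOn ha
    refine ⟨A.image Φ, ?_, ?_, fun F => g (Function.invFunOn Φ (A : Set ℝ) F), ?_, ?_⟩
    · intro F hF
      obtain ⟨a, ha, rfl⟩ := Finset.mem_image.1 hF
      refine ⟨h.isFlat hE fun x y hxy hy => hxy.trans hy, ?_, ?_⟩
      · obtain ⟨e, he⟩ := hAw a ha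
        exact ⟨e, he.le⟩
      · intro hF
        rw [hE] at hF
        have : e₀ ∈ Φ a := hF ▸ Set.mem_univ _
        exact absurd (hA a ha) (not_lt.2 this)
    · rintro F hF G hG -
      obtain ⟨a, -, rfl⟩ := Finset.mem_image.1 (Finset.mem_coe.1 hF)
      obtain ⟨b, -, rfl⟩ := Finset.mem_image.1 (Finset.mem_coe.1 hG)
      exact (le_total a b).imp (fun h => hΦmono h) fun h => hΦmono h
    · intro F hF
      obtain ⟨a, ha, rfl⟩ := Finset.mem_image.1 hF
      change 0 ≤ g (Function.invFunOn Φ (A : Set ℝ) (Φ a))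
      rw [hinv a ha]
      exact hg a ha
    · rw [mk_eq_mk_iff]
      refine ⟨w e₀, fun e => ?_⟩
      rw [sum_smul_neg_indicator_apply, Finset.sum_filter, Finset.sum_image hΦinj,
        ← Finset.sum_filter]
      have h1 := hsum (w e) (by
        rw [Finset.insert_erase (Finset.mem_image_of_mem _ (Finset.mem_univ _))]
        exact Finset.mem_image_of_mem _ (Finset.mem_univ _))
      have h2 : ∑ a ∈ A with e ∈ Φ a, g (Function.invFunOn Φ (A : Set ℝ) (Φ a)) =
          ∑ a ∈ A with w e ≤ a, g a :=
        Finset.sum_congr rfl fun a ha => by rw [hinv a (Finset.mem_filter.1 ha).1]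
      rw [h2]
      linarith

theorem isClosed_bergmanFan [Finite E] {M : Matroid E} (hE : M.E = Set.univ) :
    IsClosed (bergmanFan M) := by
  rw [← (Submodule.isQuotientMap_mkQL (Submodule.span ℝ {(1 : E → ℝ)})).isClosed_preimage]
  convert isClosed_flatSublevels M using 1
  ext w
  exact mk_mem_bergmanFan_iff hE w

end Bergman

/-! ### Valuations -/

section Valuations

variable {K : Type*} [Field K]

theorem exists_valuation_eq_coe (v : AddValuation K (WithTop ℝ)) {x : K} (hx : x ≠ 0) :
    ∃ r : ℝ, v x = r :=
  ⟨(v x).untop ((v.ne_top_iff).2 hx), (WithTop.coe_untop _ _).symm⟩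

/-- If v x were negative, the leading term of a monic equation for x would have strictly smaller
valuation than all the others and could not cancel. -/
theorem valuation_algebraic_nonneg (v : AddValuation K (WithTop ℝ)) {k : Subfield K}
    (hk : ∀ a ∈ k, a ≠ 0 → v a = 0) {x : K} (hx : IsAlgebraic k x) : 0 ≤ v x := by
  by_contra! hlt
  obtain ⟨r, hr⟩ : ∃ r : ℝ, v x = r :=
    ⟨(v x).untop (hlt.trans_le le_top).ne, (WithTop.coe_untop _ _).symm⟩
  have hr0 : r < 0 := by rw [hr] at hlt; exact_mod_cast hlt
  obtain ⟨p, hp, hpx⟩ := hx.isIntegral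
  have hpow : ∀ i : ℕ, v (x ^ i) = ((i * r : ℝ) : WithTop ℝ) := fun i => by
    rw [v.map_pow, hr, ← WithTop.coe_nsmul, nsmul_eq_mul]
  have hsum : x ^ p.natDegree =
      -∑ i ∈ Finset.range p.natDegree, (p.coeff i : K) * x ^ i := by
    rw [← Polynomial.aeval_def, hp.as_sum] at hpx
    simp only [map_add, map_pow, Polynomial.aeval_X, map_sum, map_mul, Polynomial.aeval_C] at hpx
    exact eq_neg_of_add_eq_zero_left hpx
  have hlt : v (x ^ p.natDegree) <
      v (∑ i ∈ Finset.range p.natDegree, (p.coeff i : K) * x ^ i) := by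
    refine v.map_lt_sum (by rw [hpow]; exact WithTop.coe_ne_top) fun i hi => ?_
    rw [v.map_mul, hpow, hpow]
    by_cases hc : (p.coeff i : K) = 0
    · rw [hc, v.map_zero, top_add]
      exact WithTop.coe_lt_top _
    · rw [hk _ (p.coeff i).2 hc, zero_add]
      have : (i : ℝ) < p.natDegree := by exact_mod_cast Finset.mem_range.1 hi
      exact_mod_cast mul_lt_mul_of_neg_right this hr0
  rw [hsum, v.map_neg] at hlt
  exact lt_irrefl _ hlt

theorem valuation_algebraic_eq_zero (v : AddValuation K (WithTop ℝ)) {k : Subfield K}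
    (hk : ∀ a ∈ k, a ≠ 0 → v a = 0) {x : K} (hx : IsAlgebraic k x) (hx0 : x ≠ 0) : v x = 0 := by
  have h1 := valuation_algebraic_nonneg v hk hx
  have h2 := valuation_algebraic_nonneg v hk hx.inv
  have h3 : v x + v x⁻¹ = 0 := by rw [← v.map_mul, mul_inv_cancel₀ hx0, v.map_one]
  refine le_antisymm ?_ h1
  calc v x ≤ v x + v x⁻¹ := le_add_of_nonneg_right h2
    _ = 0 := h3

/-- An m-th root divides the valuation by m, and roots exist in K. -/
theorem exists_small_valuation [IsAlgClosed K] (v : AddValuation K (WithTop ℝ))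
    (hv : ∃ a : K, a ≠ 0 ∧ v a ≠ 0) {ε : ℝ} (hε : 0 < ε) :
    ∃ (b : K) (δ : ℝ), 0 < δ ∧ δ < ε ∧ v b = δ := by
  obtain ⟨a, r, hr, hva⟩ : ∃ (a : K) (r : ℝ), 0 < r ∧ v a = r := by
    obtain ⟨a, ha, hva⟩ := hv
    obtain ⟨r, hr⟩ := exists_valuation_eq_coe v ha
    obtain ⟨s, hs⟩ := exists_valuation_eq_coe v (inv_ne_zero ha)
    have h : v a + v a⁻¹ = 0 := by rw [← v.map_mul, mul_inv_cancel₀ ha, v.map_one]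
    rw [hr, hs] at h
    have h' : r + s = 0 := by exact_mod_cast h
    have hr0 : r ≠ 0 := by rintro rfl; exact hva (by rw [hr]; rfl)
    rcases hr0.lt_or_gt with h1 | h1
    · exact ⟨a⁻¹, s, by linarith, hs⟩
    · exact ⟨a, r, h1, hr⟩
  obtain ⟨m, hm⟩ := exists_nat_gt (r / ε)
  have hm0 : 0 < (m : ℝ) := (div_pos hr hε).trans hm
  obtain ⟨b, hb⟩ := IsAlgClosed.exists_pow_nat_eq a (n := m) (by exact_mod_cast hm0)
  have hb0 : b ≠ 0 := by
    rintro rfl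
    rw [zero_pow (by rintro rfl; simp at hm0)] at hb
    rw [← hb, v.map_zero] at hva
    exact WithTop.top_ne_coe hva
  obtain ⟨s, hs⟩ := exists_valuation_eq_coe v hb0
  have h1 : (m : ℝ) * s = r := by
    have h2 := v.map_pow b m
    rw [hb, hva, hs, ← WithTop.coe_nsmul, nsmul_eq_mul] at h2
    exact_mod_cast h2.symm
  refine ⟨b, s, ?_, ?_, hs⟩
  · exact pos_of_mul_pos_right (by rw [h1]; exact hr) hm0.le
  · rw [div_lt_iff₀ hε] at hm
    rw [← h1] at hm
    exact lt_of_mul_lt_mul_left hm hm0.le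

end Valuations

/-! ### Descent to a subfield -/

section Descent

variable {F K : Type*} [Field F] [Field K] [Algebra F K]

/-- Applying an F-linear projection K → F to the coefficients turns a K-linear relation between
vectors over F into an F-linear one. -/
theorem exists_retraction (F K : Type*) [Field F] [Field K] [Algebra F K] :
    ∃ π : K →ₗ[F] F, ∀ (a : F) (x : K), π (x * algebraMap F K a) = π x * a ∧
      π (algebraMap F K a) = a := by
  obtain ⟨π, hπ⟩ := (Algebra.linearMap F K).exists_leftInverse_of_injective
    (LinearMap.ker_eq_bot.2 (algebraMap F K).injective)
  refine ⟨π, fun a x => ⟨?_, LinearMap.congr_fun hπ a⟩⟩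
  rw [mul_comm, ← Algebra.smul_def, map_smul, smul_eq_mul, mul_comm]

theorem col_map_mem_span_iff {ι E : Type*} [Finite E] (V : Matrix ι E F) (S : Set E) (e : E) :
    (V.map (algebraMap F K)).col e ∈ Submodule.span K ((V.map (algebraMap F K)).col '' S) ↔
      V.col e ∈ Submodule.span F (V.col '' S) := by
  classical
  have := Fintype.ofFinite S
  rw [Fintype.mem_span_image_iff_exists_fun, Fintype.mem_span_image_iff_exists_fun]
  constructor
  · rintro ⟨c, hc⟩
    obtain ⟨π, hπ⟩ := exists_retraction F K
    refine ⟨fun s => π (c s), ?_⟩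
    ext i
    have h := congrArg π (congrFun hc i)
    simp only [Finset.sum_apply, Pi.smul_apply, smul_eq_mul, Matrix.col, Matrix.transpose_apply,
      Matrix.map_apply, map_sum] at h ⊢
    rw [(hπ _ 0).2] at h
    rw [← h]
    exact Finset.sum_congr rfl fun s _ => ((hπ _ _).1).symm
  · rintro ⟨c, hc⟩
    refine ⟨fun s => algebraMap F K (c s), ?_⟩
    ext i
    have h := congrArg (algebraMap F K) (congrFun hc i)
    simpa [Matrix.col, Algebra.smul_def] using h

/-- A subspace cut out by equations over `F` is spanned by its points over `F`. -/
theorem exists_isRowSpace_map {m n : ℕ} (X : Gr K m n) {S : Set (Fin n → K)}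
    (hS : ∀ a ∈ S, ∃ a₀ : Fin n → F, a = fun j => algebraMap F K (a₀ j))
    (hX : (X.1 : Set (Fin n → K)) = {x | ∀ a ∈ S, a ⬝ᵥ x = 0}) :
    ∃ W : Matrix (Fin m) (Fin n) F, IsRowSpace (W.map (algebraMap F K)) X.1 := by
  classical
  have hmem : ∀ x, x ∈ X.1 ↔ ∀ a ∈ S, a ⬝ᵥ x = 0 := fun x => by
    rw [← SetLike.mem_coe, hX]; rfl
  let T : Set (Fin n → K) := {x | x ∈ X.1 ∧ ∃ y : Fin n → F, x = fun j => algebraMap F K (y j)}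
  have hT : Submodule.span K T = X.1 := by
    refine le_antisymm (Submodule.span_le.2 fun x hx => hx.1) fun x hx => ?_
    -- Expand the coordinates of x in an F-basis of K. The equations have coefficients in F, so each
    -- coefficient vector satisfies them separately, and x is a K-combination of these F-points.
    let b := Module.Basis.ofVectorSpace F K
    let s := Finset.univ.biUnion fun j => (b.repr (x j)).support
    have hxs : x = ∑ l ∈ s, b l • fun j => algebraMap F K (b.repr (x j) l) := by
      ext j
      rw [Finset.sum_apply]
      have h1 := b.linearCombination_repr (x j)
      rw [Finsupp.linearCombination_apply, Finsupp.sum_of_support_subset (s := s) _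
        (Finset.subset_biUnion_of_mem (fun j => (b.repr (x j)).support) (Finset.mem_univ j)) _
        (by simp)] at h1
      conv_lhs => rw [← h1]
      refine Finset.sum_congr rfl fun l _ => ?_
      rw [Algebra.smul_def, Pi.smul_apply, smul_eq_mul, mul_comm]
    rw [hxs]
    refine Submodule.sum_mem _ fun l _ => Submodule.smul_mem _ _ (Submodule.subset_span ⟨?_, _, rfl⟩)
    rw [hmem]
    intro a ha
    obtain ⟨a₀, rfl⟩ := hS a ha
    have h1 := congrArg (b.coord l) ((hmem x).1 hx _ ha)
    simp only [dotProduct, map_sum, map_zero, ← Algebra.smul_def, map_smul, smul_eq_mul,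
      Module.Basis.coord_apply] at h1
    have h2 := congrArg (algebraMap F K) h1
    simpa [dotProduct] using h2
  obtain ⟨B, hBT, hBspan, hB⟩ := exists_linearIndependent K T
  rw [hT] at hBspan
  have := hB.setFinite.fintype
  have hcard : Fintype.card B = m := by
    have h1 := finrank_span_eq_card hB
    rw [Subtype.range_coe, hBspan, X.2] at h1
    exact h1.symm
  let e := Fintype.equivFinOfCardEq hcard
  have hy : ∀ i, ∃ y : Fin n → F, (e.symm i).1 = fun j => algebraMap F K (y j) := fun i =>
    (hBT (e.symm i).2).2
  choose y hy using hy
  refine ⟨Matrix.of y, ?_⟩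
  rw [IsRowSpace, ← hBspan]
  congr 1
  ext x
  constructor
  · intro hx
    refine ⟨e ⟨x, hx⟩, ?_⟩
    have := hy (e ⟨x, hx⟩)
    rw [Equiv.symm_apply_apply] at this
    exact this.symm
  · rintro ⟨i, rfl⟩
    have : (Matrix.map (Matrix.of y) (algebraMap F K)).row i = (e.symm i).1 := (hy i).symm
    rw [this]
    exact (e.symm i).2

theorem map_concreteCoordinates {d n : ℕ} (W : Matrix (Fin (d + 1)) (Fin n) F) :
    concreteCoordinates (W.map (algebraMap F K)) = (concreteCoordinates W).map (algebraMap F K) := by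
  ext i J
  simp only [concreteCoordinates, maxMinor, Matrix.of_apply, Matrix.map_apply, RingHom.map_det]
  rfl

end Descent

/-! ### Tropicalization of linear spaces with constant coefficients -/

section Tropicalization

variable {F K ι E : Type*} [Field F] [Field K] [Algebra F K] [Finite E]

/-- Over an infinite field, a flat is the zero set of a single linear form on the columns. -/
theorem exists_dual_vanishing_exactly [Infinite F] (V : Matrix ι E F) {S : Set E}
    (hS : ∀ e, V.col e ∈ Submodule.span F (V.col '' S) → e ∈ S) :
    ∃ q : Module.Dual F (ι → F), ∀ e, q (V.col e) = 0 ↔ e ∈ S := by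
  -- For e outside S, the forms annihilating the span and vanishing at column e are a proper
  -- subspace of the annihilator. Over an infinite field finitely many such subspaces do not cover
  -- it.
  obtain ⟨q, hq, hq'⟩ := Module.Dual.exists_forall_mem_ne_zero_of_forall_exists
    (Submodule.span F (V.col '' S)).dualAnnihilator
    (fun e : {e // e ∉ S} => Module.Dual.eval F (ι → F) (V.col e.1)) (by
      rintro ⟨e, he⟩
      by_contra! h
      exact he (hS e ((Subspace.forall_mem_dualAnnihilator_apply_eq_zero_iff _ _).1 h)))
  refine ⟨q, fun e => ⟨fun h => ?_, fun h => ?_⟩⟩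
  · by_contra he
    exact hq' ⟨e, he⟩ h
  · exact (Submodule.mem_dualAnnihilator q).1 hq _ (Submodule.subset_span ⟨e, h, rfl⟩)

variable [Fintype ι]

/-- A column relation over F expresses p_e through the p_s with coefficients of valuation 0 or ∞. By
the ultrametric inequality the p_s cannot all have valuation larger than p_e. -/
theorem flatSublevels_neg_valuation (v : AddValuation K (WithTop ℝ))
    (hF : ∀ a : F, a ≠ 0 → v (algebraMap F K a) = 0) (V : Matrix ι E F) {p : E → K}
    (hp : p ∈ Submodule.span K (Set.range (V.map (algebraMap F K)).row)) (hp0 : ∀ e, p e ≠ 0) :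
    FlatSublevels (subspaceMatroid (Submodule.span K (Set.range (V.map (algebraMap F K)).row)))
      (fun e => -(v (p e)).untopD 0) := by
  classical
  intro S e he
  rw [mem_closure_subspaceMatroid_span_row_iff, col_map_mem_span_iff] at he
  have := Fintype.ofFinite S
  obtain ⟨c, hc⟩ := Fintype.mem_span_image_iff_exists_fun F |>.1 he
  rw [← range_vecMulLinear] at hp
  obtain ⟨x, rfl⟩ := hp
  set p := (V.map (algebraMap F K)).vecMulLinear x with hpdef
  have hpe : p e = ∑ s : S, algebraMap F K (c s) * p s := by
    simp only [hpdef, Matrix.vecMulLinear_apply, Matrix.vecMul, dotProduct, Finset.mul_sum]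
    rw [Finset.sum_comm]
    refine Finset.sum_congr rfl fun i _ => ?_
    have h1 := congrArg (algebraMap F K) (congrFun hc i)
    simp only [Finset.sum_apply, Pi.smul_apply, smul_eq_mul, Matrix.col, Matrix.transpose_apply,
      map_sum, map_mul] at h1
    rw [Matrix.map_apply, ← h1, Finset.mul_sum]
    refine Finset.sum_congr rfl fun s _ => ?_
    rw [Matrix.map_apply]
    ring
  by_contra! hcon
  obtain ⟨r, hr⟩ := exists_valuation_eq_coe v (hp0 e)
  have hlt : v (p e) < v (∑ s : S, algebraMap F K (c s) * p s) := by
    refine v.map_lt_sum (by rw [hr]; exact WithTop.coe_ne_top) fun s _ => ?_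
    rw [v.map_mul]
    by_cases hcs : c s = 0
    · rw [hcs, map_zero, v.map_zero, top_add, hr]
      exact WithTop.coe_lt_top _
    · obtain ⟨r', hr'⟩ := exists_valuation_eq_coe v (hp0 s)
      have h1 := hcon s s.2
      rw [hr, hr', WithTop.untopD_coe, WithTop.untopD_coe, neg_lt_neg_iff] at h1
      rw [hF _ hcs, zero_add, hr, hr']
      exact_mod_cast h1
  rw [← hpe] at hlt
  exact lt_irrefl _ hlt

/-- Take p = ∑ b^z q_z, where the form q_z over F vanishes exactly on the columns with z < k e. At e
the terms below k e vanish, the term z = k e has valuation k e · δ, and all later terms have larger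
valuation. -/
theorem exists_mem_span_row_valuation_eq [Infinite F] (v : AddValuation K (WithTop ℝ))
    (hF : ∀ a : F, a ≠ 0 → v (algebraMap F K a) = 0) (V : Matrix ι E F) {b : K} {δ : ℝ}
    (hδ : 0 < δ) (hb : v b = δ) {k : E → ℕ}
    (hk : FlatSublevels
      (subspaceMatroid (Submodule.span K (Set.range (V.map (algebraMap F K)).row)))
      (fun e => OrderDual.toDual (k e))) :
    ∃ p ∈ Submodule.span K (Set.range (V.map (algebraMap F K)).row),
      ∀ e, v (p e) = ((k e * δ : ℝ) : WithTop ℝ) := by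
  classical
  have := Fintype.ofFinite E
  have hq : ∀ z : ℕ, ∃ q : Module.Dual F (ι → F), ∀ e, q (V.col e) = 0 ↔ z < k e := by
    intro z
    refine exists_dual_vanishing_exactly V (S := {e | z < k e}) fun e he => ?_
    have hflat := (hk.isFlat rfl (P := fun a => z < OrderDual.ofDual a)
      fun a b hab hb => lt_of_lt_of_le hb hab).closure
    rw [← col_map_mem_span_iff (K := K), ← mem_closure_subspaceMatroid_span_row_iff] at he
    exact hflat.subset he
  choose q hq using hq
  have hpow : ∀ i : ℕ, v (b ^ i) = ((i * δ : ℝ) : WithTop ℝ) := fun i => by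
    rw [v.map_pow, hb, ← WithTop.coe_nsmul, nsmul_eq_mul]
  have hqsum : ∀ (φ : Module.Dual F (ι → F)) (y : ι → F), φ y = ∑ i, φ (Pi.single i 1) * y i := by
    intro φ y
    conv_lhs => rw [pi_eq_sum_univ' y]
    rw [map_sum]
    refine Finset.sum_congr rfl fun i _ => ?_
    rw [map_smul, smul_eq_mul, mul_comm]
  let Z := Finset.univ.image k
  let x : ι → K := fun i => ∑ z ∈ Z, b ^ z * algebraMap F K (q z (Pi.single i 1))
  have hp : ∀ e, (V.map (algebraMap F K)).vecMulLinear x e =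
      ∑ z ∈ Z, b ^ z * algebraMap F K (q z (V.col e)) := by
    intro e
    simp only [x, Matrix.vecMulLinear_apply, Matrix.vecMul, dotProduct, Finset.sum_mul]
    rw [Finset.sum_comm]
    refine Finset.sum_congr rfl fun z _ => ?_
    rw [hqsum (q z) (V.col e), map_sum, Finset.mul_sum]
    refine Finset.sum_congr rfl fun i _ => ?_
    rw [map_mul, Matrix.map_apply, Matrix.col, Matrix.transpose_apply, mul_assoc]
  refine ⟨(V.map (algebraMap F K)).vecMulLinear x, ?_, fun e => ?_⟩
  · rw [← range_vecMulLinear]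
    exact ⟨x, rfl⟩
  have hlead : v (b ^ k e * algebraMap F K (q (k e) (V.col e))) =
      ((k e * δ : ℝ) : WithTop ℝ) := by
    rw [v.map_mul, hpow, hF _ (fun h => lt_irrefl _ ((hq _ e).1 h)), add_zero]
  rw [hp, ← Finset.add_sum_erase Z _ (Finset.mem_image_of_mem k (Finset.mem_univ e)),
    v.map_add_eq_of_lt_left, hlead]
  rw [hlead]
  refine v.map_lt_sum WithTop.coe_ne_top fun z hz => ?_
  rw [v.map_mul, hpow]
  by_cases h0 : q z (V.col e) = 0
  · rw [h0, map_zero, v.map_zero, add_top]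
    exact WithTop.coe_lt_top _
  · have hlt : k e < z := by
      rw [hq, not_lt] at h0
      exact lt_of_le_of_ne h0 (Finset.ne_of_mem_erase hz).symm
    rw [hF _ h0, add_zero]
    have : (k e : ℝ) < z := by exact_mod_cast hlt
    exact_mod_cast mul_lt_mul_of_pos_right this hδ

/-- The tropicalization of a linear space with constant coefficients is the Bergman fan of its
matroid. -/
theorem tropicalization_span_row [Infinite F] [IsAlgClosed K] (v : AddValuation K (WithTop ℝ))
    (hv : ∃ a : K, a ≠ 0 ∧ v a ≠ 0) (hF : ∀ a : F, a ≠ 0 → v (algebraMap F K a) = 0)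
    (V : Matrix ι E F) :
    tropicalization v (Submodule.span K (Set.range (V.map (algebraMap F K)).row) : Set (E → K)) =
      bergmanFan (subspaceMatroid
        (Submodule.span K (Set.range (V.map (algebraMap F K)).row))) := by
  have := Fintype.ofFinite E
  set Y := Submodule.span K (Set.range (V.map (algebraMap F K)).row) with hY
  refine subset_antisymm (closure_minimal ?_ (isClosed_bergmanFan rfl)) fun x hx => ?_
  · rintro _ ⟨p, hp, hp0, rfl⟩
    exact (mk_mem_bergmanFan_iff rfl _).2 (flatSublevels_neg_valuation v hF V hp hp0)
  · obtain ⟨w, rfl⟩ := Submodule.Quotient.mk_surjective _ x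
    have hw := (mk_mem_bergmanFan_iff rfl w).1 hx
    obtain ⟨c, hc⟩ : ∃ c, ∀ e, w e ≤ c :=
      (Set.finite_range w).bddAbove.imp fun c hc e => hc ⟨e, rfl⟩
    have hmem : (fun e => w e - c) ∈
        closure {u : E → ℝ | ∃ p ∈ Y, (∀ e, p e ≠ 0) ∧ u = fun e => -(v (p e)).untopD 0} := by
      rw [Metric.mem_closure_iff]
      intro ε hε
      obtain ⟨b, δ, hδ, hδε, hb⟩ := exists_small_valuation v hv hε
      -- Subtracting c makes the weight nonpositive, and -kδ then approximates w - c within δ < ε.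
      -- The floor is monotone, so rounding keeps the flat condition.
      let k : E → ℕ := fun e => ⌊(c - w e) / δ⌋₊
      have hk : FlatSublevels (subspaceMatroid Y) (fun e => OrderDual.toDual (k e)) := by
        intro S e he
        obtain ⟨s, hs, hle⟩ := hw S e he
        refine ⟨s, hs, ?_⟩
        change k s ≤ k e
        refine Nat.floor_mono ?_
        gcongr
      obtain ⟨p, hp, hval⟩ := exists_mem_span_row_valuation_eq v hF V hδ hb hk
      refine ⟨_, ⟨p, hp, fun e h0 => ?_, rfl⟩, ?_⟩
      · have := hval e
        rw [h0, v.map_zero] at this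
        exact WithTop.top_ne_coe this
      · refine lt_of_le_of_lt ((dist_pi_le_iff hδ.le).2 fun e => ?_) hδε
        rw [hval, WithTop.untopD_coe, Real.dist_eq]
        have h1 : (k e : ℝ) * δ ≤ c - w e := by
          rw [← le_div_iff₀ hδ]
          exact Nat.floor_le (div_nonneg (sub_nonneg.2 (hc e)) hδ.le)
        have h2 : c - w e < (k e + 1) * δ := by
          rw [← div_lt_iff₀ hδ]
          exact Nat.lt_floor_add_one _
        rw [abs_le]
        constructor <;> linarith
    have hmk : (Submodule.Quotient.mk w : TropicalTorus E) =
        Submodule.Quotient.mk fun e => w e - c := mk_eq_mk_iff.2 ⟨c, fun e => by ring⟩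
    rw [hmk]
    refine map_mem_closure (f := (Submodule.Quotient.mk : (E → ℝ) → TropicalTorus E))
      (Submodule.mkQL (Submodule.span ℝ {(1 : E → ℝ)})).continuous hmem ?_
    rintro _ ⟨p, hp, hp0, rfl⟩
    exact ⟨p, hp, hp0, rfl⟩

end Tropicalization

theorem theorem7p4 {K : Type*} [Field K] [IsAlgClosed K] (n d : ℕ) (hd : d < n) :
    IsOpen (genericLocus K d n) ∧ Dense (genericLocus K d n) ∧
    ∀ X ∈ genericLocus K d n,
      (Submodule.span K (spaceLCone d X.1) : Set (SubsetsOfCard n d → K)) = spaceLCone d X.1 ∧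
      matroidOfL d X.1 = relabeledDilworth n (n - d) d ∧
      ∀ (v : AddValuation K (WithTop ℝ)) (k : Subfield K),
        (∃ a : K, a ≠ 0 ∧ v a ≠ 0) → (∀ a ∈ k, a ≠ 0 → v a = 0) →
        HasEquationsOver k X.1 →
        tropicalization v (spaceLCone d X.1) = bergmanFan (relabeledDilworth n (n - d) d) := by
  refine ⟨isOpen_genericLocus, dense_genericLocus hd, fun X hX => ?_⟩
  have hmat := matroidOfL_eq_relabeledDilworth hd hX
  refine ⟨?_, hmat, ?_⟩
  · obtain ⟨W, hW⟩ := exists_isRowSpace X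
    rw [span_spaceLCone hW, spaceLCone_eq hW]
  · rintro v k hv hk ⟨S, hSk, hS⟩
    -- The field k may be finite, whereas the choice of forms q needs an infinite field. The
    -- algebraic closure of k in K is infinite and still trivially valued.
    have := (algebraicClosure.isAlgClosure k K).isAlgClosed
    obtain ⟨W, hW⟩ := exists_isRowSpace_map (F := algebraicClosure k K) X (S := S)
      (fun a ha => ⟨fun j => algebraMap k _ ⟨a j, hSk a ha j⟩, rfl⟩) hS
    rw [← hmat, matroidOfL, span_spaceLCone hW, spaceLCone_eq hW, map_concreteCoordinates]
    refine tropicalization_span_row v hv (fun a ha => ?_) _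
    exact valuation_algebraic_eq_zero v hk (mem_algebraicClosure_iff.1 a.2)
      (by simpa using ha)
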